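/- Let $\mathscr G$ be a connected undirected graph on $\{1,\dots,n\}$ with neighbourhoods $\mathscr N_i$. UAV $i$ has position $p_i(t)\in\mathbb R^3$ and velocity $v_i(t)\in\mathbb R^3$, with $$\dot p_i=v_i,\qquad \dot v_i=u_i+d_i,\qquad t\ge 0,$$ where $d_i=(d_{xi},d_{yi},d_{zi})^T$ is the lumped disturbance. Let $r_i$ be desired trajectories with first and second derivatives $\dot r_i,\ddot r_i$. The virtual leaders $(\hat r_i,\hat v_i)$ are generated by the cooperative filter $$\dot{\hat r}_i=\hat v_i,\qquad \dot{\hat v}_i=\ddot r_i-\kappa_p\hat e_{pi}-\kappa_v\hat e_{vi}-\sum_{j\in\mathscr N_i}\big[c_p(\hat e_{pi}-\hat e_{pj})+c_v(\hat e_{vi}-\hat e_{vj})\big],\qquad \hat e_{pi}=\hat r_i-r_i,\quad \hat e_{vi}=\hat v_i-\dot r_i .$$ With $e_{pi}=p_i-\hat r_i$ and $e_{vi}=v_i-\hat v_i$, the control is $u_i=u_{0i}-\hat d_i$, with the cooperative baseline law $$u_{0i}=\ddot r_i-K_pe_{pi}-K_ve_{vi}-\sum_{j\in\mathscr N_i}\big[C_p(e_{pi}-e_{pj})+C_v(e_{vi}-e_{vj})\big]$$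 and the uncertainty and disturbance observer $$\hat d_{\rho i}(t)=\frac1{\mathcal T_{\rho i}}\Big(\dot\rho_i(t)-\dot\rho_i(0)-\int_0^tu_{\rho0i}(s)\,ds\Big),\qquad \rho\in\{x,y,z\},$$ where $\dot\rho_i$ is the $\rho$-component of $v_i$. All gain matrices $K_p,K_v,C_p,C_v,\kappa_p,\kappa_v,c_p,c_v\in\mathbb R^{3\times3}$ are diagonal and positive definite, and all $\mathcal T_{\rho i}>0$. Differential equations are understood for absolutely continuous functions. Put $\tilde d_i=\hat d_i-d_i$. 1. The closed-loop tracking error system, with state $x=(e_p,e_v,\hat e_p,\hat e_v,\tilde d)$ stacked over all UAVs, is input-to-state stable with respect to $\dot d=(\dot d_1,\dots,\dot d_n)$: there are a class $\mathcal{KL}$ function $\beta$ and a class $\mathcal K$ function $\gamma$ such that for every bounded measurable input $\dot d$ and every initial state a trajectory exists on $[0,\infty)$, and every trajectory satisfies $\|x(t)\|_2\le\beta(\|x(0)\|_2,t)+\gamma\big(\sup_{0\le\tau\le t}\|\dot d(\tau)\|_2\big)$ for all $t\ge0$. 2. Suppose that the disturbances and their derivatives are bounded, $|d_{\rho i}(t)|\le\bar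 d_{\rho i}$ and $|\dot d_{\rho i}(t)|\le\bar{\dot d}_{\rho i}$ for all $t\ge 0$, $\rho$ and $i$. Then bounded formation flight is achieved. That is, there are $\epsilon_p,\epsilon_v>0$, depending only on the graph, the design parameters and the bounds, such that for all desired trajectories, all such disturbances and all initial values of $p,v,\hat r,\hat v$ the closed loop has a solution on $[0,\infty)$, and every solution satisfies $\|p_i(t)-r_i(t)\|_2\le\epsilon_p$ and $\|v_i(t)-\dot r_i(t)\|_2\le\epsilon_v$ for all $i$ and all sufficiently large $t$. Moreover $\epsilon_p$ and $\epsilon_v$ can be made arbitrarily small by the design parameters: for all $\epsilon_p,\epsilon_v>0$ and all fixed values of the other parameters and of the bounds there are positive definite diagonal $K_p,K_v$ for which this holds. -/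

import Mathlib

open MeasureTheory Filter Topology Set

noncomputable section

namespace FormationControl

/-- Vectors of `ℝ³`, with coordinates `x`, `y`, `z` indexed by `Fin 3`, and the Euclidean norm. -/
abbrev E3 : Type := EuclideanSpace ℝ (Fin 3)

/-- Stacked vectors `[x₁ᵀ, …, xₙᵀ]ᵀ` with `xᵢ ∈ ℝ³`, with the Euclidean norm of `ℝ³ⁿ`. -/
abbrev Stack (n : ℕ) : Type := PiLp 2 (fun _ : Fin n => E3)

/-- Stacked vectors of `ℝ¹⁵ⁿ`, the error state made of five blocks of `ℝ³ⁿ`, Euclidean norm. -/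
abbrev ErrorState (n : ℕ) : Type := PiLp 2 (fun _ : Fin 5 => Stack n)

/-- `HasRate x f`: the differential equation `ẋ(t) = f(t)` on `[0, ∞)` in the sense of
Carathéodory: `f` is locally integrable and `x(t) = x(0) + ∫₀ᵗ f`. It holds for every `x` that is
differentiable on `[0, ∞)` with locally bounded (in particular with continuous) derivative `f`. -/
def HasRate {E : Type*} [NormedAddCommGroup E] [NormedSpace ℝ E] (x f : ℝ → E) : Prop :=
  ∀ t : ℝ, 0 ≤ t → IntervalIntegrable f volume 0 t ∧ x t = x 0 + ∫ s in (0 : ℝ)..t, f s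

/-! ### Input-to-state stability -/

/-- Class `K` functions on `[0, ∞)`: continuous, strictly increasing, zero at zero. -/
def IsClassK (g : ℝ → ℝ) : Prop :=
  ContinuousOn g (Ici 0) ∧ StrictMonoOn g (Ici 0) ∧ g 0 = 0

/-- Class `KL` functions on `[0, ∞) × [0, ∞)`. -/
def IsClassKL (b : ℝ → ℝ → ℝ) : Prop :=
  ContinuousOn (Function.uncurry b) (Ici 0 ×ˢ Ici 0) ∧
  (∀ t : ℝ, 0 ≤ t → IsClassK (fun s => b s t)) ∧
  (∀ s : ℝ, 0 ≤ s → AntitoneOn (b s) (Ici 0) ∧ Tendsto (b s) atTop (𝓝 0))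

/-- Admissible inputs: measurable and bounded functions on `[0, ∞)`. -/
def IsBoundedInput {U : Type*} [NormedAddCommGroup U] (w : ℝ → U) : Prop :=
  AEStronglyMeasurable w (volume.restrict (Ici (0 : ℝ))) ∧
  BddAbove ((fun t => ‖w t‖) '' Ici (0 : ℝ))

/-- Input-to-state stability of a system, given as the relation `Sys w x` that says that `x` is a
state trajectory on `[0, ∞)` under the input `w`: there are `b` of class `KL` and `g` of class `K`
such that, for every bounded input and every initial state, a trajectory exists on all of `[0, ∞)`,
and every trajectory satisfies `‖x(t)‖ ≤ b(‖x(0)‖, t) + g(sup_{0 ≤ τ ≤ t} ‖w(τ)‖)`. -/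
def InputToStateStable {U X : Type*} [NormedAddCommGroup U] [NormedAddCommGroup X]
    (Sys : (ℝ → U) → (ℝ → X) → Prop) : Prop :=
  ∃ (b : ℝ → ℝ → ℝ) (g : ℝ → ℝ), IsClassKL b ∧ IsClassK g ∧
    ∀ w : ℝ → U, IsBoundedInput w →
      (∀ x₀ : X, ∃ x : ℝ → X, Sys w x ∧ x 0 = x₀) ∧
      (∀ x : ℝ → X, Sys w x → ∀ t : ℝ, 0 ≤ t →
        ‖x t‖ ≤ b ‖x 0‖ t + g (sSup ((fun τ => ‖w τ‖) '' Icc 0 t)))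

/-! ### The controller -/

/-- The design parameters: the diagonals of the `3 × 3` gain matrices of the baseline law
(`Kp`, `Kv`, `Cp`, `Cv`) and of the cooperative filter (`κp`, `κv`, `cp`, `cv`), and the time
constants `T i ρ` of the uncertainty and disturbance observers. -/
structure Design (n : ℕ) where
  Kp : Fin 3 → ℝ
  Kv : Fin 3 → ℝ
  Cp : Fin 3 → ℝ
  Cv : Fin 3 → ℝ
  κp : Fin 3 → ℝ
  κv : Fin 3 → ℝ
  cp : Fin 3 → ℝ
  cv : Fin 3 → ℝ
  T : Fin n → Fin 3 → ℝ

/-- All gain matrices are positive definite and all time constants are positive. -/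
structure Design.Admissible {n : ℕ} (D : Design n) : Prop where
  Kp_pos : ∀ ρ, 0 < D.Kp ρ
  Kv_pos : ∀ ρ, 0 < D.Kv ρ
  Cp_pos : ∀ ρ, 0 < D.Cp ρ
  Cv_pos : ∀ ρ, 0 < D.Cv ρ
  κp_pos : ∀ ρ, 0 < D.κp ρ
  κv_pos : ∀ ρ, 0 < D.κv ρ
  cp_pos : ∀ ρ, 0 < D.cp ρ
  cv_pos : ∀ ρ, 0 < D.cv ρ
  T_pos : ∀ i ρ, 0 < D.T i ρ

/-- The product of the diagonal matrix `diag(k)` with `x`. -/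
def diagMul (k : Fin 3 → ℝ) (x : E3) : E3 := WithLp.toLp 2 (fun ρ => k ρ * x ρ)

/-- The cooperative feedback
`kp eᵢ + kv fᵢ + ∑_{j ∈ Nᵢ} [cp (eᵢ - eⱼ) + cv (fᵢ - fⱼ)]`, for position errors `e` and velocity
errors `f`. -/
def coopFeedback {n : ℕ} (G : SimpleGraph (Fin n)) [DecidableRel G.Adj]
    (kp kv cp cv : Fin 3 → ℝ) (e f : Stack n) : Stack n :=
  WithLp.toLp 2 (fun i => diagMul kp (e i) + diagMul kv (f i) +
    ∑ j ∈ G.neighborFinset i, (diagMul cp (e i - e j) + diagMul cv (f i - f j)))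

/-- The acceleration of the virtual leaders prescribed by the cooperative filter, for filter state
`(rh, vh)`, and desired position, velocity and acceleration `r`, `r₁`, `r₂`. -/
def filterAccel {n : ℕ} (G : SimpleGraph (Fin n)) [DecidableRel G.Adj] (D : Design n)
    (r r₁ r₂ rh vh : Stack n) : Stack n :=
  r₂ - coopFeedback G D.κp D.κv D.cp D.cv (rh - r) (vh - r₁)

/-- The baseline cooperative law `u₀`. -/
def baselineLaw {n : ℕ} (G : SimpleGraph (Fin n)) [DecidableRel G.Adj] (D : Design n)
    (r₂ rh vh p v : Stack n) : Stack n :=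
  r₂ - coopFeedback G D.Kp D.Kv D.Cp D.Cv (p - rh) (v - vh)

/-- The uncertainty and disturbance observer: given the velocity signal `v` and the baseline input
signal `u₀`, the estimate is
`d̂_{ρi}(t) = (1 / T_{ρi}) (v_{ρi}(t) - v_{ρi}(0) - ∫₀ᵗ u_{ρ0i})`. -/
def observer {n : ℕ} (D : Design n) (v u₀ : ℝ → Stack n) (t : ℝ) : Stack n :=
  WithLp.toLp 2 (fun i => WithLp.toLp 2 (fun ρ =>
    (1 / D.T i ρ) * (v t i ρ - v 0 i ρ - ∫ s in (0 : ℝ)..t, u₀ s i ρ)))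

/-- The baseline input along signals. -/
def baselineSignal {n : ℕ} (G : SimpleGraph (Fin n)) [DecidableRel G.Adj] (D : Design n)
    (r₂ rh vh p v : ℝ → Stack n) (t : ℝ) : Stack n :=
  baselineLaw G D (r₂ t) (rh t) (vh t) (p t) (v t)

/-- The disturbance estimate along signals of the closed loop. -/
def estimate {n : ℕ} (G : SimpleGraph (Fin n)) [DecidableRel G.Adj] (D : Design n)
    (r₂ rh vh p v : ℝ → Stack n) : ℝ → Stack n :=
  observer D v (baselineSignal G D r₂ rh vh p v)

/-! ### The closed loop -/

/-- `r₁` and `r₂` are the first and second derivatives of the desired trajectories `r`. -/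
structure IsReference {n : ℕ} (r r₁ r₂ : ℝ → Stack n) : Prop where
  vel : HasRate r r₁
  acc : HasRate r₁ r₂

/-- `(p, v, rh, vh)` is a trajectory on `[0, ∞)` of the closed loop made of the UAVs
`ṗᵢ = vᵢ`, `v̇ᵢ = uᵢ + dᵢ`, the control `uᵢ = u₀ᵢ - d̂ᵢ`, and the cooperative filter that generates
the virtual leaders `(rh, vh)`. -/
structure IsClosedLoop {n : ℕ} (G : SimpleGraph (Fin n)) [DecidableRel G.Adj] (D : Design n)
    (r r₁ r₂ d p v rh vh : ℝ → Stack n) : Prop where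
  pos : HasRate p v
  vel : HasRate v (fun t =>
    (baselineSignal G D r₂ rh vh p v t - estimate G D r₂ rh vh p v t) + d t)
  leaderPos : HasRate rh vh
  leaderVel : HasRate vh (fun t => filterAccel G D (r t) (r₁ t) (r₂ t) (rh t) (vh t))

/-- The state of the closed-loop tracking error system: the tracking errors
`e_p = p - r̂`, `e_v = v - v̂`, the filter errors `r̂ - r`, `v̂ - ṙ`, and the estimation error
`d̂ - d`. -/
def errorSignal {n : ℕ} (G : SimpleGraph (Fin n)) [DecidableRel G.Adj] (D : Design n)
    (r r₁ r₂ d p v rh vh : ℝ → Stack n) (t : ℝ) : ErrorState n :=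
  WithLp.toLp 2 ![p t - rh t, v t - vh t, rh t - r t, vh t - r₁ t,
    estimate G D r₂ rh vh p v t - d t]

/-- The closed-loop tracking error system, with the disturbance derivative `w = ḋ` as input:
`x` is the error signal of some trajectory of the closed loop, for some desired trajectories and
some disturbance with derivative `w`. -/
def errorSystem {n : ℕ} (G : SimpleGraph (Fin n)) [DecidableRel G.Adj] (D : Design n)
    (w : ℝ → Stack n) (x : ℝ → ErrorState n) : Prop :=
  ∃ r r₁ r₂ d p v rh vh : ℝ → Stack n,
    IsReference r r₁ r₂ ∧ HasRate d w ∧ IsClosedLoop G D r r₁ r₂ d p v rh vh ∧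
    ∀ t : ℝ, 0 ≤ t → x t = errorSignal G D r r₁ r₂ d p v rh vh t

/-- The disturbances `d` have derivative `w`, and both are bounded componentwise on `[0, ∞)`, by
`dbar` and `wbar`. -/
structure BoundedDisturbance {n : ℕ} (dbar wbar : Fin n → Fin 3 → ℝ)
    (d w : ℝ → Stack n) : Prop where
  rate : HasRate d w
  bound : ∀ t : ℝ, 0 ≤ t → ∀ i ρ, |d t i ρ| ≤ dbar i ρ
  rate_bound : ∀ t : ℝ, 0 ≤ t → ∀ i ρ, |w t i ρ| ≤ wbar i ρ

/-- Formation flight is achieved with ultimate bounds `εp` on the position errors and `εv` on the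
velocity errors, whatever the desired trajectories, the disturbances with the given bounds and the
initial conditions are: the closed loop has a trajectory on `[0, ∞)` from all initial conditions,
and along every trajectory the errors of all UAVs are eventually within the bounds. -/
def FormationBound {n : ℕ} (G : SimpleGraph (Fin n)) [DecidableRel G.Adj] (D : Design n)
    (dbar wbar : Fin n → Fin 3 → ℝ) (εp εv : ℝ) : Prop :=
  ∀ r r₁ r₂ d w : ℝ → Stack n, IsReference r r₁ r₂ → BoundedDisturbance dbar wbar d w →
    (∀ p₀ v₀ rh₀ vh₀ : Stack n, ∃ p v rh vh : ℝ → Stack n,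
      IsClosedLoop G D r r₁ r₂ d p v rh vh ∧ p 0 = p₀ ∧ v 0 = v₀ ∧ rh 0 = rh₀ ∧ vh 0 = vh₀) ∧
    (∀ p v rh vh : ℝ → Stack n, IsClosedLoop G D r r₁ r₂ d p v rh vh →
      ∀ᶠ t in atTop, ∀ i : Fin n, ‖p t i - r t i‖ ≤ εp ∧ ‖v t i - r₁ t i‖ ≤ εv)

end FormationControl

end

namespace FormationControl

/-! ### Carathéodory derivatives -/

section HasRate

variable {E F : Type*} [NormedAddCommGroup E] [NormedSpace ℝ E] [NormedAddCommGroup F]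
  [NormedSpace ℝ F]

theorem HasRate.congr {x f y g : ℝ → E} (h : HasRate x f) (hx : ∀ t, 0 ≤ t → y t = x t)
    (hf : ∀ t, 0 ≤ t → g t = f t) : HasRate y g := by
  intro t ht
  obtain ⟨h1, h2⟩ := h t ht
  have hfg : EqOn f g (uIoc 0 t) := fun s hs => by
    rw [uIoc_of_le ht] at hs
    exact (hf s hs.1.le).symm
  refine ⟨h1.congr hfg, ?_⟩
  rw [hx t ht, hx 0 le_rfl, h2, intervalIntegral.integral_congr_ae
    (Eventually.of_forall fun s hs => hfg hs)]

theorem HasRate.add {x f y g : ℝ → E} (h : HasRate x f) (h' : HasRate y g) :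
    HasRate (fun t => x t + y t) (fun t => f t + g t) := by
  intro t ht
  obtain ⟨h1, h2⟩ := h t ht
  obtain ⟨h3, h4⟩ := h' t ht
  refine ⟨h1.add h3, ?_⟩
  rw [intervalIntegral.integral_add h1 h3]
  change x t + y t = x 0 + y 0 + _
  rw [h2, h4]
  abel

theorem HasRate.sub {x f y g : ℝ → E} (h : HasRate x f) (h' : HasRate y g) :
    HasRate (fun t => x t - y t) (fun t => f t - g t) := by
  intro t ht
  obtain ⟨h1, h2⟩ := h t ht
  obtain ⟨h3, h4⟩ := h' t ht
  refine ⟨h1.sub h3, ?_⟩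
  rw [intervalIntegral.integral_sub h1 h3]
  change x t - y t = x 0 - y 0 + _
  rw [h2, h4]
  abel

theorem HasRate.map [CompleteSpace E] [CompleteSpace F] {x f : ℝ → E} (h : HasRate x f)
    (L : E →L[ℝ] F) :
    HasRate (fun t => L (x t)) (fun t => L (f t)) := by
  intro t ht
  obtain ⟨h1, h2⟩ := h t ht
  refine ⟨⟨L.integrable_comp h1.1, L.integrable_comp h1.2⟩, ?_⟩
  rw [L.intervalIntegral_comp_comm h1]
  change L (x t) = L (x 0) + _
  rw [h2, map_add]

theorem HasRate.const (c : E) : HasRate (fun _ => c) (fun _ => (0 : E)) := by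
  intro t _
  simp

theorem HasRate.continuousOn {x f : ℝ → E} (h : HasRate x f) : ContinuousOn x (Ici 0) := by
  intro t ht
  have ht1 : (0 : ℝ) ≤ t + 1 := by have := mem_Ici.1 ht; linarith
  have h1 : ContinuousOn (fun s => x 0 + ∫ u in (0 : ℝ)..s, f u) (uIcc 0 (t + 1)) :=
    continuousOn_const.add
      (intervalIntegral.continuousOn_primitive_interval' (h (t + 1) ht1).1 left_mem_uIcc)
  rw [uIcc_of_le ht1] at h1
  have h2 : ContinuousOn x (Icc 0 (t + 1)) :=
    h1.congr fun s hs => (h s hs.1).2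
  refine (h2 t ⟨ht, by linarith⟩).mono_of_mem_nhdsWithin ?_
  rw [← Ici_inter_Iic]
  exact inter_mem self_mem_nhdsWithin (mem_nhdsWithin_of_mem_nhds (Iic_mem_nhds (by linarith)))

theorem HasRate.hasDerivAt [CompleteSpace E] {x f : ℝ → E} (h : HasRate x f)
    (hf : ContinuousOn f (Ici 0))
    {t : ℝ} (ht : 0 < t) : HasDerivAt x (f t) t := by
  have hc : ContinuousAt f t := hf.continuousAt (Ici_mem_nhds ht)
  have hm : StronglyMeasurableAtFilter f (𝓝 t) :=
    (hf.mono Ioi_subset_Ici_self).stronglyMeasurableAtFilter isOpen_Ioi t ht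
  have h1 := (intervalIntegral.integral_hasDerivAt_right (h t ht.le).1 hm hc).const_add (x 0)
  refine h1.congr_of_eventuallyEq ?_
  filter_upwards [Ici_mem_nhds ht] with s hs
  exact (h s hs).2

theorem HasRate.of_hasDerivAt [CompleteSpace E] {x f : ℝ → E} (h : ∀ t, HasDerivAt x (f t) t)
    (hf : Continuous f) : HasRate x f := by
  intro t _
  refine ⟨hf.intervalIntegrable _ _, ?_⟩
  rw [intervalIntegral.integral_eq_sub_of_hasDerivAt (fun s _ => h s) (hf.intervalIntegrable _ _)]
  abel

omit [NormedSpace ℝ E] in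
theorem intervalIntegrable_of_continuousOn_Ici {f : ℝ → E} (hf : ContinuousOn f (Ici 0)) {t : ℝ}
    (ht : 0 ≤ t) : IntervalIntegrable f volume 0 t := by
  apply ContinuousOn.intervalIntegrable
  rw [uIcc_of_le ht]
  exact hf.mono Icc_subset_Ici_self

/-- Global solution of a linear differential equation with continuous inhomogeneity. -/
theorem exists_linear_solution [CompleteSpace E] (A : E →L[ℝ] E) {b : ℝ → E} (hb : Continuous b)
    (x₀ : E) : ∃ x : ℝ → E, x 0 = x₀ ∧ ∀ t, HasDerivAt x (A (x t) + b t) t := by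
  let Φ : ℝ → E →L[ℝ] E := fun t => NormedSpace.exp (t • A)
  have hΦ : ∀ t, HasDerivAt Φ (A * Φ t) t := fun t => hasDerivAt_exp_smul_const' A t
  have hΦc : Continuous Φ := continuous_iff_continuousAt.2 fun t => (hΦ t).continuousAt
  have hinv : ∀ t, Φ t * Φ (-t) = 1 := fun t => by
    have hcomm : Commute (t • A) ((-t) • A) :=
      ((Commute.refl A).smul_left t).smul_right (-t)
    let _ := NormedAlgebra.restrictScalars ℚ ℝ (E →L[ℝ] E)
    change NormedSpace.exp (t • A) * NormedSpace.exp ((-t) • A) = 1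
    rw [← NormedSpace.exp_add_of_commute hcomm, ← add_smul]
    simp
  have hg : Continuous fun s => Φ (-s) (b s) := (hΦc.comp continuous_neg).clm_apply hb
  refine ⟨fun t => Φ t (x₀ + ∫ s in (0 : ℝ)..t, Φ (-s) (b s)), by simp [Φ], fun t => ?_⟩
  have h1 : HasDerivAt (fun t => x₀ + ∫ s in (0 : ℝ)..t, Φ (-s) (b s)) (Φ (-t) (b t)) t :=
    (intervalIntegral.integral_hasDerivAt_right (hg.intervalIntegrable _ _)
      (hg.stronglyMeasurableAtFilter _ _) hg.continuousAt).const_add x₀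
  have h2 := (hΦ t).clm_apply h1
  convert h2 using 1
  have h3 : Φ t (Φ (-t) (b t)) = b t := by
    rw [← mul_apply_eq_comp, hinv]; rfl
  rw [h3]
  rfl

end HasRate

/-! ### Differential inequalities -/

/-- Integrated form of `y' ≤ -l y + a e^{-m s} + b` on `[0, t]`. -/
theorem le_of_hasDerivAt_le_neg_mul {y y' : ℝ → ℝ} {t l m a b : ℝ} (ht : 0 ≤ t) (hl : 0 < l)
    (hlm : l < m) (hc : ContinuousOn y (Icc 0 t)) (hy : ∀ s ∈ Ioo 0 t, HasDerivAt y (y' s) s)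
    (hle : ∀ s ∈ Ioo 0 t, y' s ≤ -l * y s + (a * Real.exp (-m * s) + b)) (ha : 0 ≤ a)
    (hb : 0 ≤ b) :
    y t ≤ Real.exp (-l * t) * (y 0 + a / (m - l)) + b / l := by
  have hml : 0 < m - l := sub_pos.2 hlm
  let h : ℝ → ℝ := fun s => Real.exp (l * s) * (y s - b / l) +
    a / (m - l) * Real.exp (-(m - l) * s)
  have hd : ∀ s ∈ Ioo 0 t, HasDerivAt h (Real.exp (l * s) * (l * y s - b + y' s) -
      a * Real.exp (-(m - l) * s)) s := by
    intro s hs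
    have e1 : HasDerivAt (fun s => Real.exp (l * s)) (Real.exp (l * s) * (l * 1)) s :=
      ((hasDerivAt_id s).const_mul l).exp
    have e2 : HasDerivAt (fun s => Real.exp (-(m - l) * s))
        (Real.exp (-(m - l) * s) * (-(m - l) * 1)) s :=
      ((hasDerivAt_id s).const_mul (-(m - l))).exp
    refine ((e1.mul ((hy s hs).sub_const (b / l))).add (e2.const_mul (a / (m - l)))).congr_deriv ?_
    field_simp
    ring
  have hanti : AntitoneOn h (Icc 0 t) := by
    refine antitoneOn_of_deriv_nonpos (convex_Icc 0 t) ?_ ?_ ?_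
    · refine ContinuousOn.add (ContinuousOn.mul ?_ (hc.sub continuousOn_const)) ?_ <;> fun_prop
    · rw [interior_Icc]
      exact fun s hs => (hd s hs).differentiableAt.differentiableWithinAt
    · rw [interior_Icc]
      intro s hs
      rw [(hd s hs).deriv]
      have e : Real.exp (-(m - l) * s) = Real.exp (l * s) * Real.exp (-m * s) := by
        rw [← Real.exp_add]; ring_nf
      rw [e]
      have := mul_le_mul_of_nonneg_left (hle s hs) (Real.exp_pos (l * s)).le
      nlinarith
  have h0 := hanti (left_mem_Icc.2 ht) (right_mem_Icc.2 ht) ht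
  simp only [h, mul_zero, Real.exp_zero, one_mul, mul_one] at h0
  have hpos : 0 ≤ a / (m - l) * Real.exp (-(m - l) * t) := by positivity
  have hbl : 0 ≤ b / l := by positivity
  have h1 : Real.exp (l * t) * (y t - b / l) ≤ y 0 + a / (m - l) := by linarith
  have h2 := mul_le_mul_of_nonneg_left h1 (Real.exp_pos (-l * t)).le
  rw [← mul_assoc, ← Real.exp_add] at h2
  have : -l * t + l * t = 0 := by ring
  rw [this, Real.exp_zero, one_mul] at h2
  linarith

theorem HasRate.le_of_first_order {y w : ℝ → ℝ} {a M t : ℝ} (ha : 0 < a) (ht : 0 ≤ t)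
    (h : HasRate y (fun s => -(a * y s) - w s)) (hM : ∀ s ∈ Icc 0 t, |w s| ≤ M) :
    y t ≤ Real.exp (-a * t) * |y 0| + M / a := by
  have hyc := h.continuousOn
  have hM0 : 0 ≤ M := (abs_nonneg _).trans (hM 0 ⟨le_rfl, ht⟩)
  have hwi : ∀ s, 0 ≤ s → IntervalIntegrable w volume 0 s := fun s hs => by
    have := ((intervalIntegrable_of_continuousOn_Ici hyc hs).const_mul (-a)).sub (h s hs).1
    refine this.congr fun u _ => ?_
    ring
  let ω : ℝ → ℝ := fun s => (∫ u in (0 : ℝ)..s, w u) - ∫ u in (0 : ℝ)..t, w u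
  have hωr : HasRate ω w := fun s hs => ⟨hwi s hs, by simp [ω]; ring⟩
  have hωb : ∀ s ∈ Icc 0 t, |ω s| ≤ M * (t - s) := by
    intro s hs
    have e : ω s = ∫ u in t..s, w u :=
      intervalIntegral.integral_interval_sub_left (hwi s hs.1) (hwi t ht)
    rw [e, ← Real.norm_eq_abs]
    refine (intervalIntegral.norm_integral_le_of_norm_le_const (C := M) fun u hu => ?_).trans ?_
    · rw [uIoc_of_ge hs.2] at hu
      exact hM u ⟨hs.1.trans hu.1.le, hu.2⟩
    · rw [abs_of_nonpos (by linarith [hs.2])]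
      linarith
  have hz : HasRate (fun s => y s + ω s) (fun s => -(a * y s)) :=
    (h.add hωr).congr (fun _ _ => rfl) fun s _ => by ring
  let g : ℝ → ℝ := fun s => Real.exp (a * s) * (y s + ω s) -
    (Real.exp (a * s) * (M * (t - s)) + Real.exp (a * s) * (M / a))
  have hd : ∀ s ∈ Ioo 0 t, HasDerivAt g (Real.exp (a * s) * (a * (ω s - M * (t - s)))) s := by
    intro s hs
    have e1 : HasDerivAt (fun s => Real.exp (a * s)) (Real.exp (a * s) * (a * 1)) s :=
      ((hasDerivAt_id s).const_mul a).exp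
    have e2 : HasDerivAt (fun s => M * (t - s)) (M * (-1)) s :=
      ((hasDerivAt_id s).const_sub t).const_mul M
    have e3 := hz.hasDerivAt (continuousOn_const.mul hyc).neg hs.1
    refine ((e1.mul e3).sub ((e1.mul e2).add (e1.mul_const (M / a)))).congr_deriv ?_
    field_simp
    ring
  have hanti : AntitoneOn g (Icc 0 t) := by
    refine antitoneOn_of_deriv_nonpos (convex_Icc 0 t) ?_ ?_ ?_
    · refine ContinuousOn.sub (ContinuousOn.mul ?_ (hz.continuousOn.mono Icc_subset_Ici_self)) ?_
        <;> fun_prop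
    · rw [interior_Icc]
      exact fun s hs => (hd s hs).differentiableAt.differentiableWithinAt
    · rw [interior_Icc]
      intro s hs
      rw [(hd s hs).deriv]
      have := (abs_le.1 (hωb s ⟨hs.1.le, hs.2.le⟩)).2
      exact mul_nonpos_of_nonneg_of_nonpos (Real.exp_pos _).le
        (mul_nonpos_of_nonneg_of_nonpos ha.le (by linarith))
  have h0 := hanti (left_mem_Icc.2 ht) (right_mem_Icc.2 ht) ht
  have hωt : ω t = 0 := sub_self _
  have hω0 := (abs_le.1 (hωb 0 ⟨le_rfl, ht⟩)).2
  have hMa : 0 ≤ M / a := by positivity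
  simp only [g, mul_zero, Real.exp_zero, one_mul, hωt, sub_self, add_zero, zero_add, sub_zero]
    at h0
  have h1 : Real.exp (a * t) * (y t - M / a) ≤ |y 0| := by linarith [le_abs_self (y 0)]
  have h2 := mul_le_mul_of_nonneg_left h1 (Real.exp_pos (-a * t)).le
  rw [← mul_assoc, ← Real.exp_add] at h2
  have : -a * t + a * t = 0 := by ring
  rw [this, Real.exp_zero, one_mul] at h2
  linarith

/-- A scalar first-order lag forgets its initial value and attenuates its input. -/
theorem HasRate.abs_le_of_first_order {y w : ℝ → ℝ} {a M t : ℝ} (ha : 0 < a) (ht : 0 ≤ t)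
    (h : HasRate y (fun s => -(a * y s) - w s)) (hM : ∀ s ∈ Icc 0 t, |w s| ≤ M) :
    |y t| ≤ Real.exp (-a * t) * |y 0| + M / a := by
  refine abs_le'.2 ⟨h.le_of_first_order ha ht hM, ?_⟩
  have hn : HasRate (fun s => -y s) (fun s => -(a * -y s) - -w s) :=
    ((HasRate.const (0 : ℝ)).sub h).congr (fun _ _ => by ring) fun _ _ => by ring
  simpa using hn.le_of_first_order ha ht (by simpa using hM)

/-! ### Second-order systems -/

section SecondOrder

variable {E : Type*} [NormedAddCommGroup E] [InnerProductSpace ℝ E]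

local notation "⟪" x ", " y "⟫" => inner ℝ x y

/-- The stiffness `P` and the damping `V` are symmetric, with `p ≤ P`, `v ≤ V` and `V ≤ m P`. -/
structure IsDamped (P V : E →L[ℝ] E) (p v m : ℝ) : Prop where
  symm_P : ∀ x y, ⟪P x, y⟫ = ⟪x, P y⟫
  symm_V : ∀ x y, ⟪V x, y⟫ = ⟪x, V y⟫
  p_pos : 0 < p
  v_pos : 0 < v
  m_pos : 0 < m
  le_P : ∀ x, p * ‖x‖ ^ 2 ≤ ⟪x, P x⟫
  le_V : ∀ x, v * ‖x‖ ^ 2 ≤ ⟪x, V x⟫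
  V_le : ∀ x, ⟪x, V x⟫ ≤ m * ⟪x, P x⟫

/-- Lyapunov function of `e' = f`, `f' = -P e - V f`. -/
noncomputable def energy (P V : E →L[ℝ] E) (v : ℝ) (e f : E) : ℝ :=
  ‖f‖ ^ 2 / 2 + ⟪e, P e⟫ / 2 + v / 2 * ⟪e, f⟫ + v / 4 * ⟪e, V e⟫

namespace IsDamped

variable {P V : E →L[ℝ] E} {p v m : ℝ}

theorem le_energy (h : IsDamped P V p v m) (e f : E) :
    ‖f‖ ^ 2 / 4 + p / 2 * ‖e‖ ^ 2 ≤ energy P V v e f := by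
  have h1 := h.le_P e
  have h2 := mul_le_mul_of_nonneg_left (h.le_V e) h.v_pos.le
  have h3 : 0 ≤ ‖(2 : ℝ)⁻¹ • f + (v / 2) • e‖ ^ 2 := sq_nonneg _
  rw [norm_add_sq_real, norm_smul, norm_smul, real_inner_smul_left, real_inner_smul_right,
    real_inner_comm, mul_pow, mul_pow, Real.norm_eq_abs, Real.norm_eq_abs, sq_abs, sq_abs] at h3
  unfold energy
  linarith

theorem energy_le (h : IsDamped P V p v m) (e f : E) :
    energy P V v e f ≤ (1 + v ^ 2 / (8 * p) + v * m / 4) * (‖f‖ ^ 2 + ⟪e, P e⟫) := by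
  have hp := h.p_pos
  have hv := h.v_pos
  have hm := h.m_pos
  have h1 := h.le_P e
  have h0 : 0 ≤ ⟪e, P e⟫ := le_trans (by positivity) h1
  have h2 := mul_le_mul_of_nonneg_left (h.V_le e) hv.le
  have h3 : 0 ≤ ‖f - (v / 2) • e‖ ^ 2 := sq_nonneg _
  rw [norm_sub_sq_real, norm_smul, real_inner_smul_right,
    real_inner_comm, mul_pow, Real.norm_eq_abs, sq_abs] at h3
  have h4 : v ^ 2 / (8 * p) * (p * ‖e‖ ^ 2) ≤ v ^ 2 / (8 * p) * ⟪e, P e⟫ :=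
    mul_le_mul_of_nonneg_left h1 (by positivity)
  have h5 : v ^ 2 / (8 * p) * (p * ‖e‖ ^ 2) = v ^ 2 / 8 * ‖e‖ ^ 2 := by field_simp
  have h6 : 0 ≤ (v ^ 2 / (8 * p) + v * m / 4) * ‖f‖ ^ 2 := by positivity
  unfold energy
  linarith

/-- Rate of change of the energy along `e' = f`, `f' = -P e - V f + u`. -/
theorem hasDerivAt_energy (h : IsDamped P V p v m) {e f : ℝ → E} {u : E} {t : ℝ}
    (he : HasDerivAt e (f t) t) (hf : HasDerivAt f (-P (e t) - V (f t) + u) t) :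
    HasDerivAt (fun s => energy P V v (e s) (f s))
      (-⟪f t, V (f t)⟫ + v / 2 * ‖f t‖ ^ 2 - v / 2 * ⟪e t, P (e t)⟫ +
        ⟪f t + (v / 2) • e t, u⟫) t := by
  have hPe : HasDerivAt (fun s => P (e s)) (P (f t)) t := P.hasFDerivAt.comp_hasDerivAt t he
  have hVe : HasDerivAt (fun s => V (e s)) (V (f t)) t := V.hasFDerivAt.comp_hasDerivAt t he
  have d := ((((hf.inner ℝ hf).div_const 2).add ((he.inner ℝ hPe).div_const 2)).add
    ((he.inner ℝ hf).const_mul (v / 2))).add ((he.inner ℝ hVe).const_mul (v / 4))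
  have e1 : (fun s => energy P V v (e s) (f s)) = fun s =>
      ⟪f s, f s⟫ / 2 + ⟪e s, P (e s)⟫ / 2 + v / 2 * ⟪e s, f s⟫ + v / 4 * ⟪e s, V (e s)⟫ := by
    funext s
    rw [energy, real_inner_self_eq_norm_sq]
  rw [e1]
  refine d.congr_deriv ?_
  have s1 : ⟪f t, P (e t)⟫ = ⟪e t, P (f t)⟫ := by rw [← h.symm_P, real_inner_comm]
  have s2 : ⟪f t, V (e t)⟫ = ⟪e t, V (f t)⟫ := by rw [← h.symm_V, real_inner_comm]
  have s3 : ⟪P (e t), f t⟫ = ⟪e t, P (f t)⟫ := h.symm_P _ _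
  have s4 : ⟪V (f t), f t⟫ = ⟪f t, V (f t)⟫ := h.symm_V _ _
  have s5 : ⟪u, f t⟫ = ⟪f t, u⟫ := real_inner_comm _ _
  simp only [inner_add_left, inner_add_right, inner_sub_left, inner_sub_right, inner_neg_left,
    inner_neg_right, real_inner_smul_left, s1, s2, s3, s4, s5, real_inner_self_eq_norm_sq]
  ring

theorem dissipation_le (h : IsDamped P V p v m) (e f u : E) :
    -⟪f, V f⟫ + v / 2 * ‖f‖ ^ 2 - v / 2 * ⟪e, P e⟫ + ⟪f + (v / 2) • e, u⟫ ≤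
      -(v / 4 / (1 + v ^ 2 / (8 * p) + v * m / 4)) * energy P V v e f +
        (1 / v + v / (4 * p)) * ‖u‖ ^ 2 := by
  have hp := h.p_pos
  have hv := h.v_pos
  have hm := h.m_pos
  have hc : 0 < 1 + v ^ 2 / (8 * p) + v * m / 4 := by positivity
  have h0 : v / 4 / (1 + v ^ 2 / (8 * p) + v * m / 4) * energy P V v e f ≤
      v / 4 * (‖f‖ ^ 2 + ⟪e, P e⟫) := by
    rw [div_mul_eq_mul_div, div_le_iff₀ hc]
    have := mul_le_mul_of_nonneg_left (h.energy_le e f) (by positivity : 0 ≤ v / 4)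
    linarith
  have h1 := h.le_P e
  have h2 := h.le_V f
  have h3 : ⟪f, u⟫ ≤ v / 4 * ‖f‖ ^ 2 + 1 / v * ‖u‖ ^ 2 := by
    refine (real_inner_le_norm f u).trans ?_
    have : v / 4 * ‖f‖ ^ 2 + 1 / v * ‖u‖ ^ 2 - ‖f‖ * ‖u‖ = v * (‖f‖ / 2 - ‖u‖ / v) ^ 2 := by
      field_simp
      ring
    nlinarith [mul_nonneg hv.le (sq_nonneg (‖f‖ / 2 - ‖u‖ / v))]
  have h4 : ⟪e, u⟫ ≤ p / 2 * ‖e‖ ^ 2 + 1 / (2 * p) * ‖u‖ ^ 2 := by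
    refine (real_inner_le_norm e u).trans ?_
    have : p / 2 * ‖e‖ ^ 2 + 1 / (2 * p) * ‖u‖ ^ 2 - ‖e‖ * ‖u‖ = p / 2 * (‖e‖ - ‖u‖ / p) ^ 2 := by
      field_simp
      ring
    nlinarith [mul_nonneg hp.le (sq_nonneg (‖e‖ - ‖u‖ / p))]
  have h5 : v / 2 * ⟪e, u⟫ ≤ v / 4 * ⟪e, P e⟫ + v / (4 * p) * ‖u‖ ^ 2 := by
    have h6 : ⟪e, u⟫ ≤ ⟪e, P e⟫ / 2 + 1 / (2 * p) * ‖u‖ ^ 2 := by linarith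
    have h7 := mul_le_mul_of_nonneg_left h6 (by positivity : 0 ≤ v / 2)
    have h8 : v / 2 * (⟪e, P e⟫ / 2 + 1 / (2 * p) * ‖u‖ ^ 2) =
      v / 4 * ⟪e, P e⟫ + v / (4 * p) * ‖u‖ ^ 2 := by field_simp; ring
    linarith
  rw [inner_add_left, real_inner_smul_left]
  linarith

/-- Exponential decay of the energy up to the size of the input. -/
theorem energy_decay [CompleteSpace E] (h : IsDamped P V p v m) {e f u : ℝ → E}
    (he : HasRate e f)
    (hf : HasRate f (fun s => -P (e s) - V (f s) + u s)) (hu : ContinuousOn u (Ici 0))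
    {t l μ a b : ℝ} (ht : 0 ≤ t) (hl : 0 < l) (hlμ : l < μ)
    (hl' : l ≤ v / 4 / (1 + v ^ 2 / (8 * p) + v * m / 4)) (ha : 0 ≤ a) (hb : 0 ≤ b)
    (hub : ∀ s ∈ Icc 0 t, ‖u s‖ ^ 2 ≤ a * Real.exp (-μ * s) + b) :
    energy P V v (e t) (f t) ≤ Real.exp (-l * t) * (energy P V v (e 0) (f 0) +
      (1 / v + v / (4 * p)) * a / (μ - l)) + (1 / v + v / (4 * p)) * b / l := by
  have hp := h.p_pos
  have hv := h.v_pos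
  have hec := he.continuousOn
  have hfc := hf.continuousOn
  have hg : 0 ≤ 1 / v + v / (4 * p) := by positivity
  have hrc : ContinuousOn (fun s => -P (e s) - V (f s) + u s) (Ici 0) :=
    ((P.continuous.comp_continuousOn hec).neg.sub (V.continuous.comp_continuousOn hfc)).add hu
  refine le_of_hasDerivAt_le_neg_mul (y := fun s => energy P V v (e s) (f s)) ht hl hlμ ?_
    (fun s hs => h.hasDerivAt_energy (he.hasDerivAt hfc hs.1) (hf.hasDerivAt hrc hs.1))
    (fun s hs => (h.dissipation_le _ _ _).trans ?_) (by positivity) (by positivity)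
  · have hPc := P.continuous.comp_continuousOn hec
    have hVc := V.continuous.comp_continuousOn hec
    refine ContinuousOn.mono ?_ Icc_subset_Ici_self
    unfold energy
    exact ((((hfc.norm.pow 2).div_const 2).add ((hec.inner (𝕜 := ℝ) hPc).div_const 2)).add
      (continuousOn_const.mul (hec.inner (𝕜 := ℝ) hfc))).add (continuousOn_const.mul (hec.inner (𝕜 := ℝ) hVc))
  · have h1 := mul_le_mul_of_nonneg_left (hub s ⟨hs.1.le, hs.2.le⟩) hg
    have h0 : 0 ≤ energy P V v (e s) (f s) := le_trans (by positivity) (h.le_energy _ _)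
    have h2 := mul_le_mul_of_nonneg_right hl' h0
    linarith

end IsDamped

end SecondOrder

variable {n : ℕ}

/-! ### The operators of the closed loop -/

/-- The coordinate `ρ` of agent `i`. -/
noncomputable def coordCLM (i : Fin n) (ρ : Fin 3) : Stack n →L[ℝ] ℝ :=
  (EuclideanSpace.proj ρ : E3 →L[ℝ] ℝ).comp (PiLp.proj 2 (fun _ : Fin n => E3) i)

theorem coordCLM_apply (i : Fin n) (ρ : Fin 3) (x : Stack n) : coordCLM i ρ x = x i ρ := rfl

theorem inner_stack (x y : Stack n) : inner ℝ x y = ∑ i, ∑ ρ, x i ρ * y i ρ := by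
  simp only [PiLp.inner_apply]
  refine Finset.sum_congr rfl fun i _ => Finset.sum_congr rfl fun ρ _ => ?_
  simp [mul_comm]

theorem norm_sq_stack (x : Stack n) : ‖x‖ ^ 2 = ∑ i, ∑ ρ, x i ρ ^ 2 := by
  rw [← real_inner_self_eq_norm_sq, inner_stack]
  simp only [sq]

theorem abs_coord_le_norm (x : Stack n) (i : Fin n) (ρ : Fin 3) : |x i ρ| ≤ ‖x‖ := by
  refine abs_le_of_sq_le_sq ?_ (norm_nonneg _)
  rw [norm_sq_stack]
  refine le_trans ?_ (Finset.single_le_sum (f := fun i => ∑ ρ, x i ρ ^ 2)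
    (fun i _ => Finset.sum_nonneg fun ρ _ => sq_nonneg _) (Finset.mem_univ i))
  exact Finset.single_le_sum (f := fun ρ => x i ρ ^ 2) (fun ρ _ => sq_nonneg _)
    (Finset.mem_univ ρ)

theorem norm_le_sum_abs (x : Stack n) : ‖x‖ ≤ ∑ i, ∑ ρ, |x i ρ| := by
  refine abs_le_of_sq_le_sq' ?_ (Finset.sum_nonneg fun i _ => Finset.sum_nonneg fun ρ _ =>
    abs_nonneg _) |>.2
  rw [norm_sq_stack]
  have h : ∀ i, ∑ ρ, x i ρ ^ 2 ≤ (∑ ρ, |x i ρ|) ^ 2 := fun i => by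
    simpa using Finset.sum_sq_le_sq_sum_of_nonneg (s := Finset.univ) (f := fun ρ => |x i ρ|)
      fun ρ _ => abs_nonneg _
  exact (Finset.sum_le_sum fun i _ => h i).trans
    (Finset.sum_sq_le_sq_sum_of_nonneg fun i _ => Finset.sum_nonneg fun ρ _ => abs_nonneg _)

/-- The operator `x ↦ (diag(k) xᵢ + ∑_{j ∈ Nᵢ} diag(c) (xᵢ - xⱼ))ᵢ`, as a linear map. -/
noncomputable def gainLin (G : SimpleGraph (Fin n)) [DecidableRel G.Adj] (k c : Fin 3 → ℝ) :
    Stack n →ₗ[ℝ] Stack n where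
  toFun x := WithLp.toLp 2 fun i => diagMul k (x i) +
    ∑ j ∈ G.neighborFinset i, diagMul c (x i - x j)
  map_add' x y := by
    ext i ρ
    simp [diagMul, mul_add, mul_sub, Finset.sum_add_distrib, Finset.sum_sub_distrib]
    ring
  map_smul' a x := by
    ext i ρ
    simp only [diagMul, PiLp.add_apply, PiLp.smul_apply, PiLp.sub_apply, WithLp.ofLp_sum,
      Finset.sum_apply, smul_eq_mul, RingHom.id_apply, mul_add, Finset.mul_sum]
    congr 1
    · ring
    · exact Finset.sum_congr rfl fun j _ => by ring

/-- The operator `x ↦ (diag(k) xᵢ + ∑_{j ∈ Nᵢ} diag(c) (xᵢ - xⱼ))ᵢ`. -/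
noncomputable def gainOp (G : SimpleGraph (Fin n)) [DecidableRel G.Adj] (k c : Fin 3 → ℝ) :
    Stack n →L[ℝ] Stack n :=
  ⟨gainLin G k c, by
    change Continuous fun x : Stack n => (WithLp.toLp 2 fun i => diagMul k (x i) +
      ∑ j ∈ G.neighborFinset i, diagMul c (x i - x j) : Stack n)
    unfold diagMul
    fun_prop⟩

section Gain

variable (G : SimpleGraph (Fin n)) [DecidableRel G.Adj]

theorem gainOp_apply (k c : Fin 3 → ℝ) (x : Stack n) (i : Fin n) (ρ : Fin 3) :
    gainOp G k c x i ρ = k ρ * x i ρ + ∑ j ∈ G.neighborFinset i, c ρ * (x i ρ - x j ρ) := by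
  change (diagMul k (x i) + ∑ j ∈ G.neighborFinset i, diagMul c (x i - x j)) ρ = _
  simp [diagMul]

theorem coopFeedback_eq (kp kv cp cv : Fin 3 → ℝ) (e f : Stack n) :
    coopFeedback G kp kv cp cv e f = gainOp G kp cp e + gainOp G kv cv f := by
  ext i ρ
  rw [PiLp.add_apply, PiLp.add_apply, gainOp_apply, gainOp_apply]
  simp [coopFeedback, diagMul, Finset.sum_add_distrib]
  ring

theorem inner_gainOp (k c : Fin 3 → ℝ) (x y : Stack n) :
    inner ℝ x (gainOp G k c y) = (∑ i, ∑ ρ, k ρ * (x i ρ * y i ρ)) +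
      (∑ i, ∑ j, if G.Adj i j then ∑ ρ, c ρ * ((x i ρ - x j ρ) * (y i ρ - y j ρ)) else 0) / 2 := by
  have hq : ∀ i, ∑ ρ, x i ρ * ∑ j ∈ G.neighborFinset i, c ρ * (y i ρ - y j ρ) =
      ∑ j, if G.Adj i j then ∑ ρ, c ρ * (x i ρ * (y i ρ - y j ρ)) else 0 := fun i => by
    rw [← Finset.sum_filter, ← SimpleGraph.neighborFinset_eq_filter]
    simp only [Finset.mul_sum]
    rw [Finset.sum_comm]
    exact Finset.sum_congr rfl fun j _ => Finset.sum_congr rfl fun ρ _ => by ring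
  have hs : (∑ i, ∑ j, if G.Adj i j then ∑ ρ, c ρ * (x i ρ * (y i ρ - y j ρ)) else 0) =
      ∑ i, ∑ j, if G.Adj i j then ∑ ρ, c ρ * (-x j ρ * (y i ρ - y j ρ)) else 0 := by
    rw [Finset.sum_comm]
    refine Finset.sum_congr rfl fun i _ => Finset.sum_congr rfl fun j _ => ?_
    simp only [G.adj_comm j i]
    split_ifs
    · exact Finset.sum_congr rfl fun ρ _ => by ring
    · rfl
  have ht : (∑ i, ∑ j, if G.Adj i j then
        ∑ ρ, c ρ * ((x i ρ - x j ρ) * (y i ρ - y j ρ)) else 0) =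
      (∑ i, ∑ j, if G.Adj i j then ∑ ρ, c ρ * (x i ρ * (y i ρ - y j ρ)) else 0) +
      ∑ i, ∑ j, if G.Adj i j then ∑ ρ, c ρ * (-x j ρ * (y i ρ - y j ρ)) else 0 := by
    rw [← Finset.sum_add_distrib]
    refine Finset.sum_congr rfl fun i _ => ?_
    rw [← Finset.sum_add_distrib]
    refine Finset.sum_congr rfl fun j _ => ?_
    split_ifs
    · rw [← Finset.sum_add_distrib]
      exact Finset.sum_congr rfl fun ρ _ => by ring
    · simp
  rw [ht, ← hs, inner_stack]
  simp only [gainOp_apply, mul_add, Finset.sum_add_distrib, hq]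
  rw [add_self_div_two]
  congr 1
  exact Finset.sum_congr rfl fun i _ => Finset.sum_congr rfl fun ρ _ => by ring

theorem gainOp_symm (k c : Fin 3 → ℝ) (x y : Stack n) :
    inner ℝ (gainOp G k c x) y = inner ℝ x (gainOp G k c y) := by
  rw [real_inner_comm, inner_gainOp, inner_gainOp]
  simp only [mul_comm]

theorem le_inner_gainOp {k c : Fin 3 → ℝ} {a : ℝ} (hk : ∀ ρ, a ≤ k ρ) (hc : ∀ ρ, 0 < c ρ)
    (x : Stack n) : a * ‖x‖ ^ 2 ≤ inner ℝ x (gainOp G k c x) := by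
  rw [inner_gainOp, norm_sq_stack, Finset.mul_sum]
  have h1 : ∑ i, a * ∑ ρ, x i ρ ^ 2 ≤ ∑ i, ∑ ρ, k ρ * (x i ρ * x i ρ) := by
    refine Finset.sum_le_sum fun i _ => ?_
    rw [Finset.mul_sum]
    refine Finset.sum_le_sum fun ρ _ => ?_
    rw [← sq]
    exact mul_le_mul_of_nonneg_right (hk ρ) (sq_nonneg _)
  have h2 : 0 ≤ ∑ i, ∑ j, if G.Adj i j then
      ∑ ρ, c ρ * ((x i ρ - x j ρ) * (x i ρ - x j ρ)) else 0 := by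
    refine Finset.sum_nonneg fun i _ => Finset.sum_nonneg fun j _ => ?_
    split_ifs
    · exact Finset.sum_nonneg fun ρ _ => mul_nonneg (hc ρ).le (mul_self_nonneg _)
    · exact le_rfl
  linarith

theorem gainOp_const (k : ℝ) (c : Fin 3 → ℝ) (x : Stack n) :
    gainOp G (fun _ => k) c x = k • x + gainOp G 0 c x := by
  ext i ρ
  rw [PiLp.add_apply, PiLp.add_apply, gainOp_apply, gainOp_apply]
  simp

theorem inner_clm_le {E : Type*} [NormedAddCommGroup E] [InnerProductSpace ℝ E] (A : E →L[ℝ] E)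
    (x : E) : inner ℝ x (A x) ≤ ‖A‖ * ‖x‖ ^ 2 := by
  have := mul_le_mul_of_nonneg_left (A.le_opNorm x) (norm_nonneg x)
  linarith [real_inner_le_norm x (A x)]

theorem exists_pos_le {ι : Type*} [Finite ι] {f : ι → ℝ} (hf : ∀ i, 0 < f i) :
    ∃ a, 0 < a ∧ ∀ i, a ≤ f i := by
  rcases isEmpty_or_nonempty ι with h | h
  · exact ⟨1, one_pos, fun i => (h.false i).elim⟩
  · obtain ⟨i, hi⟩ := Finite.exists_min f
    exact ⟨f i, hf i, hi⟩

theorem exists_isDamped {kp kv cp cv : Fin 3 → ℝ} (hkp : ∀ ρ, 0 < kp ρ) (hkv : ∀ ρ, 0 < kv ρ)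
    (hcp : ∀ ρ, 0 < cp ρ) (hcv : ∀ ρ, 0 < cv ρ) :
    ∃ p v m, IsDamped (gainOp G kp cp) (gainOp G kv cv) p v m := by
  obtain ⟨p, hp, hpk⟩ := exists_pos_le hkp
  obtain ⟨v, hv, hvk⟩ := exists_pos_le hkv
  refine ⟨p, v, (‖gainOp G kv cv‖ + 1) / p, gainOp_symm G _ _, gainOp_symm G _ _, hp, hv,
    by positivity, le_inner_gainOp G hpk hcp, le_inner_gainOp G hvk hcv, fun x => ?_⟩
  have h1 := inner_clm_le (gainOp G kv cv) x
  have h2 := mul_le_mul_of_nonneg_left (le_inner_gainOp G hpk hcp x)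
    (by positivity : 0 ≤ (‖gainOp G kv cv‖ + 1) / p)
  have h3 : (‖gainOp G kv cv‖ + 1) / p * (p * ‖x‖ ^ 2) = (‖gainOp G kv cv‖ + 1) * ‖x‖ ^ 2 := by
    field_simp
  nlinarith [sq_nonneg ‖x‖]

theorem isDamped_const {cp cv : Fin 3 → ℝ} (hcp : ∀ ρ, 0 < cp ρ) (hcv : ∀ ρ, 0 < cv ρ) {k : ℝ}
    (hk : 0 < k) (hkc : ‖gainOp G 0 cv‖ ≤ k) :
    IsDamped (gainOp G (fun _ => k ^ 2) cp) (gainOp G (fun _ => k) cv) (k ^ 2) k (2 / k) := by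
  refine ⟨gainOp_symm G _ _, gainOp_symm G _ _, by positivity, hk, by positivity,
    le_inner_gainOp G (fun _ => le_rfl) hcp, le_inner_gainOp G (fun _ => le_rfl) hcv, fun x => ?_⟩
  have h1 := inner_clm_le (gainOp G 0 cv) x
  have h2 := mul_le_mul_of_nonneg_left (le_inner_gainOp G (k := fun _ => k ^ 2)
    (fun _ => le_rfl) hcp x) (by positivity : 0 ≤ 2 / k)
  have h3 : 2 / k * (k ^ 2 * ‖x‖ ^ 2) = 2 * (k * ‖x‖ ^ 2) := by
    field_simp
  have h4 := mul_le_mul_of_nonneg_right hkc (sq_nonneg ‖x‖)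
  rw [gainOp_const, inner_add_right, real_inner_smul_right, real_inner_self_eq_norm_sq]
  linarith

end Gain

/-- Multiplication of the coordinates by the inverse time constants of the observers, as a linear
map. -/
noncomputable def invTimeLin (D : Design n) : Stack n →ₗ[ℝ] Stack n where
  toFun x := WithLp.toLp 2 fun i => WithLp.toLp 2 fun ρ => 1 / D.T i ρ * x i ρ
  map_add' x y := by
    ext i ρ
    simp [mul_add]
  map_smul' a x := by
    ext i ρ
    simp only [PiLp.smul_apply, smul_eq_mul, RingHom.id_apply]
    ring

/-- Multiplication of the coordinates by the inverse time constants of the observers. -/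
noncomputable def invTimeOp (D : Design n) : Stack n →L[ℝ] Stack n :=
  ⟨invTimeLin D, by
    change Continuous fun x : Stack n => (WithLp.toLp 2 fun i => WithLp.toLp 2 fun ρ =>
      1 / D.T i ρ * x i ρ : Stack n)
    fun_prop⟩

theorem invTimeOp_apply (D : Design n) (x : Stack n) (i : Fin n) (ρ : Fin 3) :
    invTimeOp D x i ρ = 1 / D.T i ρ * x i ρ := rfl

theorem observer_eq (D : Design n) (v u₀ : ℝ → Stack n) {t : ℝ}
    (h : IntervalIntegrable u₀ volume 0 t) :
    observer D v u₀ t = invTimeOp D (v t - v 0 - ∫ s in (0 : ℝ)..t, u₀ s) := by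
  ext i ρ
  rw [invTimeOp_apply, PiLp.sub_apply, PiLp.sub_apply, PiLp.sub_apply, PiLp.sub_apply]
  have := (coordCLM i ρ).intervalIntegral_comp_comm h
  simp only [coordCLM_apply] at this
  rw [← this]
  rfl

/-! ### Error dynamics -/

/-- The differential equations of the tracking errors `e, f`, the filter errors `eh, fh` and the
estimation error `δ`. -/
structure IsErrorDynamics (G : SimpleGraph (Fin n)) [DecidableRel G.Adj] (D : Design n)
    (w e f eh fh δ : ℝ → Stack n) : Prop where
  pos : HasRate e f
  vel : HasRate f (fun t => -gainOp G D.Kp D.Cp (e t) - gainOp G D.Kv D.Cv (f t) +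
    (gainOp G D.κp D.cp (eh t) + gainOp G D.κv D.cv (fh t) - δ t))
  leaderPos : HasRate eh fh
  leaderVel : HasRate fh (fun t => -gainOp G D.κp D.cp (eh t) - gainOp G D.κv D.cv (fh t))
  est : HasRate δ (fun t => -invTimeOp D (δ t) - w t)

section ClosedLoop

variable {G : SimpleGraph (Fin n)} [DecidableRel G.Adj] {D : Design n}
  {r r₁ r₂ d p v rh vh w : ℝ → Stack n}

theorem baselineSignal_eq (t : ℝ) : baselineSignal G D r₂ rh vh p v t =
    r₂ t - (gainOp G D.Kp D.Cp (p t - rh t) + gainOp G D.Kv D.Cv (v t - vh t)) := by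
  rw [baselineSignal, baselineLaw, coopFeedback_eq]

theorem intervalIntegrable_baselineSignal (hr : HasRate r₁ r₂) (hp : ContinuousOn p (Ici 0))
    (hv : ContinuousOn v (Ici 0)) (hrh : ContinuousOn rh (Ici 0)) (hvh : ContinuousOn vh (Ici 0))
    {t : ℝ} (ht : 0 ≤ t) :
    IntervalIntegrable (baselineSignal G D r₂ rh vh p v) volume 0 t := by
  have h : ContinuousOn (fun t => gainOp G D.Kp D.Cp (p t - rh t) +
      gainOp G D.Kv D.Cv (v t - vh t)) (Ici 0) :=
    ((gainOp G D.Kp D.Cp).continuous.comp_continuousOn (hp.sub hrh)).add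
      ((gainOp G D.Kv D.Cv).continuous.comp_continuousOn (hv.sub hvh))
  exact ((hr t ht).1.sub (intervalIntegrable_of_continuousOn_Ici h ht)).congr
    fun s _ => (baselineSignal_eq s).symm

theorem estimate_eq (hr : HasRate r₁ r₂) (hp : ContinuousOn p (Ici 0))
    (hv : ContinuousOn v (Ici 0)) (hrh : ContinuousOn rh (Ici 0)) (hvh : ContinuousOn vh (Ici 0))
    {t : ℝ} (ht : 0 ≤ t) : estimate G D r₂ rh vh p v t =
      invTimeOp D (v t - v 0 - ∫ s in (0 : ℝ)..t, baselineSignal G D r₂ rh vh p v s) :=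
  observer_eq D v _ (intervalIntegrable_baselineSignal hr hp hv hrh hvh ht)

theorem IsClosedLoop.hasRate_estimate (hr : IsReference r r₁ r₂)
    (h : IsClosedLoop G D r r₁ r₂ d p v rh vh) :
    HasRate (estimate G D r₂ rh vh p v)
      (fun t => invTimeOp D (d t - estimate G D r₂ rh vh p v t)) := by
  have hp := h.pos.continuousOn
  have hv := h.vel.continuousOn
  have hrh := h.leaderPos.continuousOn
  have hvh := h.leaderVel.continuousOn
  have hU : HasRate (fun t => ∫ s in (0 : ℝ)..t, baselineSignal G D r₂ rh vh p v s)
      (baselineSignal G D r₂ rh vh p v) := fun t ht =>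
    ⟨intervalIntegrable_baselineSignal hr.acc hp hv hrh hvh ht, by simp⟩
  refine (((h.vel.sub (HasRate.const (v 0))).sub hU).map (invTimeOp D)).congr
    (fun t ht => estimate_eq hr.acc hp hv hrh hvh ht) fun t _ => ?_
  congr 1
  abel

theorem IsClosedLoop.isErrorDynamics (hr : IsReference r r₁ r₂) (hd : HasRate d w)
    (h : IsClosedLoop G D r r₁ r₂ d p v rh vh) :
    IsErrorDynamics G D w (fun t => p t - rh t) (fun t => v t - vh t) (fun t => rh t - r t)
      (fun t => vh t - r₁ t) (fun t => estimate G D r₂ rh vh p v t - d t) where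
  pos := h.pos.sub h.leaderPos
  vel := (h.vel.sub h.leaderVel).congr (fun _ _ => rfl) fun t _ => by
    rw [baselineSignal_eq, filterAccel, coopFeedback_eq]
    abel
  leaderPos := h.leaderPos.sub hr.vel
  leaderVel := (h.leaderVel.sub hr.acc).congr (fun _ _ => rfl) fun t _ => by
    rw [filterAccel, coopFeedback_eq]
    abel
  est := ((h.hasRate_estimate hr).sub hd).congr (fun _ _ => rfl) fun t _ => by
    rw [← map_neg, neg_sub]

/-- The closed loop has a global trajectory from all initial conditions. -/
theorem exists_isClosedLoop (G : SimpleGraph (Fin n)) [DecidableRel G.Adj] (D : Design n)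
    (hr : IsReference r r₁ r₂) (hd : HasRate d w)
    (p₀ v₀ rh₀ vh₀ : Stack n) : ∃ p v rh vh : ℝ → Stack n,
      IsClosedLoop G D r r₁ r₂ d p v rh vh ∧ p 0 = p₀ ∧ v 0 = v₀ ∧ rh 0 = rh₀ ∧ vh 0 = vh₀ := by
  let P := gainOp G D.Kp D.Cp
  let V := gainOp G D.Kv D.Cv
  let P' := gainOp G D.κp D.cp
  let V' := gainOp G D.κv D.cv
  let Θ := invTimeOp D
  let b : ℝ → Stack n := fun t => d (max t 0)
  have hb : Continuous b := by
    have : Continuous ((Ici (0 : ℝ)).domRestrict d) :=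
      continuousOn_iff_continuous_domRestrict.1 hd.continuousOn
    exact this.comp (Continuous.subtype_mk (by fun_prop : Continuous fun t : ℝ => max t 0)
      fun t => le_max_right t 0)
  have hbd : ∀ t, 0 ≤ t → b t = d t := fun t ht => by simp [b, max_eq_left ht]
  let π₁ := ContinuousLinearMap.proj (R := ℝ) (φ := fun _ : Fin 5 => Stack n) 0
  let π₂ := ContinuousLinearMap.proj (R := ℝ) (φ := fun _ : Fin 5 => Stack n) 1
  let π₃ := ContinuousLinearMap.proj (R := ℝ) (φ := fun _ : Fin 5 => Stack n) 2
  let π₄ := ContinuousLinearMap.proj (R := ℝ) (φ := fun _ : Fin 5 => Stack n) 3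
  let π₅ := ContinuousLinearMap.proj (R := ℝ) (φ := fun _ : Fin 5 => Stack n) 4
  let A : (Fin 5 → Stack n) →L[ℝ] (Fin 5 → Stack n) := ContinuousLinearMap.pi
    ![π₂, -(P ∘L π₁) - V ∘L π₂ + (P' ∘L π₃ + V' ∘L π₄ - π₅), π₄,
      -(P' ∘L π₃) - V' ∘L π₄, -(Θ ∘L π₅)]
  have hbc : Continuous fun t => (![0, b t, 0, 0, Θ (b t)] : Fin 5 → Stack n) := by
    refine continuous_pi fun i => ?_
    fin_cases i
    · exact continuous_const
    · exact hb
    · exact continuous_const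
    · exact continuous_const
    · exact Θ.continuous.comp hb
  obtain ⟨x, hx0, hx⟩ := exists_linear_solution A hbc
    ![p₀ - rh₀, v₀ - vh₀, rh₀ - r 0, vh₀ - r₁ 0, 0]
  have hxc : Continuous x := continuous_iff_continuousAt.2 fun t => (hx t).continuousAt
  have hxr : HasRate x (fun t => A (x t) + ![0, b t, 0, 0, Θ (b t)]) :=
    HasRate.of_hasDerivAt hx ((A.continuous.comp hxc).add hbc)
  have he : HasRate (fun t => x t 0) (fun t => x t 1) :=
    (hxr.map π₁).congr (fun _ _ => rfl) fun t _ => (add_zero _).symm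
  have hf : HasRate (fun t => x t 1) (fun t => -P (x t 0) - V (x t 1) +
      (P' (x t 2) + V' (x t 3) - x t 4) + b t) :=
    (hxr.map π₂).congr (fun _ _ => rfl) fun t _ => rfl
  have heh : HasRate (fun t => x t 2) (fun t => x t 3) :=
    (hxr.map π₃).congr (fun _ _ => rfl) fun t _ => (add_zero _).symm
  have hfh : HasRate (fun t => x t 3) (fun t => -P' (x t 2) - V' (x t 3)) :=
    (hxr.map π₄).congr (fun _ _ => rfl) fun t _ => (add_zero _).symm
  have hδ : HasRate (fun t => x t 4) (fun t => -Θ (x t 4) + Θ (b t)) :=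
    (hxr.map π₅).congr (fun _ _ => rfl) fun t _ => rfl
  let rh : ℝ → Stack n := fun t => x t 2 + r t
  let vh : ℝ → Stack n := fun t => x t 3 + r₁ t
  let p : ℝ → Stack n := fun t => x t 0 + rh t
  let v : ℝ → Stack n := fun t => x t 1 + vh t
  have hrh : HasRate rh vh := heh.add hr.vel
  have hvh : HasRate vh (fun t => filterAccel G D (r t) (r₁ t) (r₂ t) (rh t) (vh t)) :=
    (hfh.add hr.acc).congr (fun _ _ => rfl) fun t _ => by
      simp only [filterAccel, coopFeedback_eq, rh, vh, P', V', add_sub_cancel_right]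
      abel
  have hp : HasRate p v := he.add hrh
  have hv : HasRate v (fun t => (baselineSignal G D r₂ rh vh p v t - x t 4) + b t) :=
    (hf.add hvh).congr (fun _ _ => rfl) fun t _ => by
      simp only [baselineSignal_eq, filterAccel, coopFeedback_eq, p, v, rh, vh, P, V, P', V',
        add_sub_cancel_right]
      abel
  have hest : ∀ t, 0 ≤ t → estimate G D r₂ rh vh p v t = x t 4 := by
    intro t ht
    have hu := intervalIntegrable_baselineSignal (G := G) (D := D) hr.acc hp.continuousOn
      hv.continuousOn hrh.continuousOn hvh.continuousOn ht
    have hbx : IntervalIntegrable (fun s => b s - x s 4) volume 0 t :=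
      (hb.sub ((continuous_apply 4).comp hxc)).intervalIntegrable _ _
    rw [estimate_eq hr.acc hp.continuousOn hv.continuousOn hrh.continuousOn hvh.continuousOn ht,
      (hv t ht).2]
    have e1 : (fun s => (baselineSignal G D r₂ rh vh p v s - x s 4) + b s) =
        fun s => baselineSignal G D r₂ rh vh p v s + (b s - x s 4) := by
      funext s; abel
    have e2 : x 0 4 = 0 := by rw [hx0]; rfl
    have e3 : x t 4 = x 0 4 + ∫ s in (0 : ℝ)..t, (-Θ (x s 4) + Θ (b s)) := (hδ t ht).2
    rw [e2, zero_add] at e3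
    beta_reduce
    rw [e1, intervalIntegral.integral_add hu hbx, add_sub_cancel_left, add_sub_cancel_left, e3,
      ← Θ.intervalIntegral_comp_comm hbx]
    refine intervalIntegral.integral_congr fun s _ => ?_
    simp only [map_sub]
    abel
  refine ⟨p, v, rh, vh, ⟨hp, hv.congr (fun _ _ => rfl) fun t ht => ?_, hrh, hvh⟩, ?_, ?_, ?_, ?_⟩
  · rw [hest t ht, hbd t ht]
  all_goals simp [p, v, rh, vh, hx0]

end ClosedLoop

/-! ### Estimates -/

theorem IsDamped.energy_le_norm_sq {E : Type*} [NormedAddCommGroup E] [InnerProductSpace ℝ E]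
    {P V : E →L[ℝ] E} {p v m : ℝ} (h : IsDamped P V p v m) (e f : E) :
    energy P V v e f ≤
      (1 + v ^ 2 / (8 * p) + v * m / 4) * (1 + ‖P‖) * (‖e‖ ^ 2 + ‖f‖ ^ 2) := by
  have hp := h.p_pos
  have hv := h.v_pos
  have hm := h.m_pos
  refine (h.energy_le e f).trans ?_
  rw [mul_assoc]
  refine mul_le_mul_of_nonneg_left ?_ (by positivity)
  have h1 := inner_clm_le P e
  have h2 : 0 ≤ ‖P‖ * ‖f‖ ^ 2 := by positivity
  nlinarith [sq_nonneg ‖e‖]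

theorem IsDamped.exists_decay {E : Type*} [NormedAddCommGroup E] [InnerProductSpace ℝ E]
    [CompleteSpace E] {P V : E →L[ℝ] E} {p v m μ : ℝ} (h : IsDamped P V p v m) (hμ : 0 < μ) :
    ∃ C l, 0 < C ∧ 0 < l ∧ l < μ ∧ ∀ e f u : ℝ → E, HasRate e f →
      HasRate f (fun s => -P (e s) - V (f s) + u s) → ContinuousOn u (Ici 0) →
      ∀ t a b : ℝ, 0 ≤ t → 0 ≤ a → 0 ≤ b →
      (∀ s ∈ Icc 0 t, ‖u s‖ ^ 2 ≤ a * Real.exp (-μ * s) + b) →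
      ‖e t‖ ^ 2 + ‖f t‖ ^ 2 ≤ C * (Real.exp (-l * t) * (‖e 0‖ ^ 2 + ‖f 0‖ ^ 2 + a) + b) := by
  have hp := h.p_pos
  have hv := h.v_pos
  have hm := h.m_pos
  let c := 1 + v ^ 2 / (8 * p) + v * m / 4
  have hc : 0 < c := by positivity
  let l := min (μ / 2) (v / 4 / c)
  have hl : 0 < l := by positivity
  have hlμ : l < μ := (min_le_left _ _).trans_lt (by linarith)
  have hml : 0 < μ - l := sub_pos.2 hlμ
  let g := 1 / v + v / (4 * p)
  have hg : 0 < g := by positivity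
  refine ⟨(4 + 2 / p) * (c * (1 + ‖P‖) + g / (μ - l) + g / l), l, by positivity, hl, hlμ, ?_⟩
  intro e f u he hf hu t a b ht ha hb hub
  have h1 := h.energy_decay he hf hu ht hl hlμ (min_le_right _ _) ha hb hub
  have h2 := h.le_energy (e t) (f t)
  have h3 := h.energy_le_norm_sq (e 0) (f 0)
  have h4 : ‖e t‖ ^ 2 + ‖f t‖ ^ 2 ≤ (4 + 2 / p) * (‖f t‖ ^ 2 / 4 + p / 2 * ‖e t‖ ^ 2) := by
    have : (4 + 2 / p) * (‖f t‖ ^ 2 / 4 + p / 2 * ‖e t‖ ^ 2) = ‖e t‖ ^ 2 + ‖f t‖ ^ 2 +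
        (2 / p * (‖f t‖ ^ 2 / 4) + 2 * p * ‖e t‖ ^ 2) := by
      field_simp
      ring
    rw [this]
    exact le_add_of_nonneg_right (by positivity)
  have h5 : energy P V v (e t) (f t) ≤ Real.exp (-l * t) *
      (c * (1 + ‖P‖) * (‖e 0‖ ^ 2 + ‖f 0‖ ^ 2) + g * a / (μ - l)) + g * b / l :=
    h1.trans (by gcongr)
  have h6 : Real.exp (-l * t) *
      (c * (1 + ‖P‖) * (‖e 0‖ ^ 2 + ‖f 0‖ ^ 2) + g * a / (μ - l)) + g * b / l ≤
      (c * (1 + ‖P‖) + g / (μ - l) + g / l) *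
        (Real.exp (-l * t) * (‖e 0‖ ^ 2 + ‖f 0‖ ^ 2 + a) + b) := by
    have e1 : (c * (1 + ‖P‖) + g / (μ - l) + g / l) *
        (Real.exp (-l * t) * (‖e 0‖ ^ 2 + ‖f 0‖ ^ 2 + a) + b) =
        Real.exp (-l * t) *
      (c * (1 + ‖P‖) * (‖e 0‖ ^ 2 + ‖f 0‖ ^ 2) + g * a / (μ - l)) + g * b / l +
      (c * (1 + ‖P‖) * (Real.exp (-l * t) * a + b) +
        g / (μ - l) * (Real.exp (-l * t) * (‖e 0‖ ^ 2 + ‖f 0‖ ^ 2) + b) +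
        g / l * (Real.exp (-l * t) * (‖e 0‖ ^ 2 + ‖f 0‖ ^ 2 + a))) := by ring
    rw [e1]
    exact le_add_of_nonneg_right (by positivity)
  calc ‖e t‖ ^ 2 + ‖f t‖ ^ 2 ≤ (4 + 2 / p) * (‖f t‖ ^ 2 / 4 + p / 2 * ‖e t‖ ^ 2) := h4
    _ ≤ (4 + 2 / p) * ((c * (1 + ‖P‖) + g / (μ - l) + g / l) *
        (Real.exp (-l * t) * (‖e 0‖ ^ 2 + ‖f 0‖ ^ 2 + a) + b)) := by
      gcongr
      exact h2.trans (h5.trans h6)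
    _ = _ := by ring

/-- The estimation error decays up to the size of the disturbance rate. -/
theorem exists_estimation_decay {D : Design n} (hD : D.Admissible) :
    ∃ C a, 0 < C ∧ 0 < a ∧ ∀ δ w : ℝ → Stack n, HasRate δ (fun s => -invTimeOp D (δ s) - w s) →
      ∀ t M : ℝ, 0 ≤ t → (∀ s ∈ Icc 0 t, ‖w s‖ ≤ M) →
      ‖δ t‖ ^ 2 ≤ C * (Real.exp (-a * t) * ‖δ 0‖ ^ 2 + M ^ 2) := by
  obtain ⟨a, ha, haT⟩ := exists_pos_le (f := fun q : Fin n × Fin 3 => 1 / D.T q.1 q.2)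
    fun q => one_div_pos.2 (hD.T_pos q.1 q.2)
  refine ⟨2 + n * (3 * (2 / a ^ 2)), a, by positivity, ha, fun δ w h t M ht hM => ?_⟩
  have hM0 : 0 ≤ M := (norm_nonneg _).trans (hM 0 ⟨le_rfl, ht⟩)
  have hcoord : ∀ i ρ, δ t i ρ ^ 2 ≤
      2 * Real.exp (-a * t) * δ 0 i ρ ^ 2 + 2 / a ^ 2 * M ^ 2 := fun i ρ => by
    have hb : a ≤ 1 / D.T i ρ := haT (i, ρ)
    have h1 : |δ t i ρ| ≤ Real.exp (-(1 / D.T i ρ) * t) * |δ 0 i ρ| + M / (1 / D.T i ρ) :=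
      HasRate.abs_le_of_first_order (y := fun s => δ s i ρ) (w := fun s => w s i ρ)
        (ha.trans_le hb) ht
        ((h.map (coordCLM i ρ)).congr (fun _ _ => rfl) fun s _ => rfl)
        fun s hs => (abs_coord_le_norm _ _ _).trans (hM s hs)
    have h2 : Real.exp (-(1 / D.T i ρ) * t) ≤ Real.exp (-a * t) :=
      Real.exp_le_exp.2 (by nlinarith)
    have h3 : |δ t i ρ| ≤ Real.exp (-a * t) * |δ 0 i ρ| + M / a :=
      h1.trans (add_le_add (mul_le_mul_of_nonneg_right h2 (abs_nonneg _))
        (div_le_div_of_nonneg_left hM0 ha hb))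
    have h4 : Real.exp (-a * t) ≤ 1 := Real.exp_le_one_iff.2 (by nlinarith)
    have h5 : Real.exp (-a * t) ^ 2 ≤ Real.exp (-a * t) := by
      nlinarith [Real.exp_pos (-a * t)]
    calc δ t i ρ ^ 2 = |δ t i ρ| ^ 2 := (sq_abs _).symm
      _ ≤ (Real.exp (-a * t) * |δ 0 i ρ| + M / a) ^ 2 := by gcongr
      _ ≤ 2 * ((Real.exp (-a * t) * |δ 0 i ρ|) ^ 2 + (M / a) ^ 2) := add_sq_le
      _ = 2 * Real.exp (-a * t) ^ 2 * δ 0 i ρ ^ 2 + 2 / a ^ 2 * M ^ 2 := by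
        rw [mul_pow, sq_abs]; ring
      _ ≤ _ := by gcongr
  rw [norm_sq_stack (δ t)]
  calc ∑ i, ∑ ρ, δ t i ρ ^ 2 ≤
      ∑ i, ∑ ρ, (2 * Real.exp (-a * t) * δ 0 i ρ ^ 2 + 2 / a ^ 2 * M ^ 2) :=
        Finset.sum_le_sum fun i _ => Finset.sum_le_sum fun ρ _ => hcoord i ρ
    _ = 2 * Real.exp (-a * t) * ‖δ 0‖ ^ 2 + n * (3 * (2 / a ^ 2 * M ^ 2)) := by
      rw [norm_sq_stack]
      simp only [Finset.sum_add_distrib, ← Finset.mul_sum, Finset.sum_const, Finset.card_univ,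
        Fintype.card_fin, nsmul_eq_mul]
      push_cast
      ring
    _ ≤ (2 + n * (3 * (2 / a ^ 2))) * (Real.exp (-a * t) * ‖δ 0‖ ^ 2 + M ^ 2) := by
      have : 0 ≤ 2 * M ^ 2 + n * (3 * (2 / a ^ 2)) * (Real.exp (-a * t) * ‖δ 0‖ ^ 2) := by
        positivity
      linarith

/-- Decay of the filter errors, of the estimation error, and of the input to the tracking errors,
with constants that do not depend on the gains of the baseline law. -/
theorem exists_input_decay (G : SimpleGraph (Fin n)) [DecidableRel G.Adj] {D : Design n}
    (hD : D.Admissible) : ∃ C μ, 0 < C ∧ 0 < μ ∧ ∀ Kp Kv : Fin 3 → ℝ,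
      ∀ w e f eh fh δ : ℝ → Stack n,
      IsErrorDynamics G { D with Kp := Kp, Kv := Kv } w e f eh fh δ →
      ∀ t M : ℝ, 0 ≤ t → (∀ s ∈ Icc 0 t, ‖w s‖ ≤ M) →
      ‖eh t‖ ^ 2 + ‖fh t‖ ^ 2 ≤
        C * (‖eh 0‖ ^ 2 + ‖fh 0‖ ^ 2 + ‖δ 0‖ ^ 2) * Real.exp (-μ * t) ∧
      ‖δ t‖ ^ 2 ≤
        C * (‖eh 0‖ ^ 2 + ‖fh 0‖ ^ 2 + ‖δ 0‖ ^ 2) * Real.exp (-μ * t) + C * M ^ 2 ∧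
      ‖gainOp G D.κp D.cp (eh t) + gainOp G D.κv D.cv (fh t) - δ t‖ ^ 2 ≤
        C * (‖eh 0‖ ^ 2 + ‖fh 0‖ ^ 2 + ‖δ 0‖ ^ 2) * Real.exp (-μ * t) + C * M ^ 2 := by
  obtain ⟨p, v, m, hPV⟩ := exists_isDamped G hD.κp_pos hD.κv_pos hD.cp_pos hD.cv_pos
  obtain ⟨C₁, l, hC₁, hl, -, h₁⟩ := hPV.exists_decay one_pos
  obtain ⟨C₂, a, hC₂, ha, h₂⟩ := exists_estimation_decay hD
  let P := gainOp G D.κp D.cp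
  let V := gainOp G D.κv D.cv
  let N := 3 * (‖P‖ ^ 2 + ‖V‖ ^ 2 + 1)
  have hN : 1 ≤ N := by
    have : 0 ≤ ‖P‖ ^ 2 + ‖V‖ ^ 2 := by positivity
    simp only [N]; linarith
  refine ⟨N * (C₁ + C₂), min l a, by positivity, by positivity, ?_⟩
  intro Kp Kv w e f eh fh δ h t M ht hM
  have hX₁ : 0 ≤ ‖eh 0‖ ^ 2 + ‖fh 0‖ ^ 2 := by positivity
  have hX₂ : 0 ≤ ‖δ 0‖ ^ 2 := by positivity
  have e₁ : ‖eh t‖ ^ 2 + ‖fh t‖ ^ 2 ≤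
      C₁ * (Real.exp (-l * t) * (‖eh 0‖ ^ 2 + ‖fh 0‖ ^ 2)) := by
    have := h₁ eh fh (fun _ => 0) h.leaderPos
      (h.leaderVel.congr (fun _ _ => rfl) fun _ _ => add_zero _) continuousOn_const t 0 0 ht
      le_rfl le_rfl fun s _ => by simp
    simpa using this
  have e₂ : ‖δ t‖ ^ 2 ≤ C₂ * (Real.exp (-a * t) * ‖δ 0‖ ^ 2 + M ^ 2) := h₂ δ w h.est t M ht hM
  set X := ‖eh 0‖ ^ 2 + ‖fh 0‖ ^ 2 + ‖δ 0‖ ^ 2 with hX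
  set r := Real.exp (-(min l a) * t) with hr
  have hr0 : 0 < r := Real.exp_pos _
  have r₁ : Real.exp (-l * t) ≤ r := Real.exp_le_exp.2 (by nlinarith [min_le_left l a])
  have r₂ : Real.exp (-a * t) ≤ r := Real.exp_le_exp.2 (by nlinarith [min_le_right l a])
  have f₁ : ‖eh t‖ ^ 2 + ‖fh t‖ ^ 2 ≤ C₁ * (X * r) := by
    refine e₁.trans (mul_le_mul_of_nonneg_left ?_ hC₁.le)
    rw [mul_comm]
    exact mul_le_mul (by linarith) r₁ (Real.exp_pos _).le (by linarith)
  have f₂ : ‖δ t‖ ^ 2 ≤ C₂ * (X * r) + C₂ * M ^ 2 := by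
    rw [← mul_add]
    refine e₂.trans (mul_le_mul_of_nonneg_left ?_ hC₂.le)
    rw [mul_comm (Real.exp _)]
    exact add_le_add_left (mul_le_mul (by linarith) r₂ (Real.exp_pos _).le (by linarith)) _
  have hXr : 0 ≤ X * r := mul_nonneg (by linarith) hr0.le
  have hM2 : 0 ≤ M ^ 2 := sq_nonneg M
  have g₁ : C₁ * (X * r) ≤ N * (C₁ + C₂) * X * r := by
    rw [mul_assoc _ X r]
    refine mul_le_mul_of_nonneg_right ?_ hXr
    nlinarith
  have g₂ : C₂ * (X * r) + C₂ * M ^ 2 ≤ N * (C₁ + C₂) * X * r + N * (C₁ + C₂) * M ^ 2 := by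
    have : C₂ ≤ N * (C₁ + C₂) := by nlinarith
    rw [mul_assoc _ X r]
    exact add_le_add (mul_le_mul_of_nonneg_right this hXr) (mul_le_mul_of_nonneg_right this hM2)
  refine ⟨f₁.trans g₁, f₂.trans g₂, ?_⟩
  have u₁ : ‖P (eh t) + V (fh t) - δ t‖ ≤ ‖P‖ * ‖eh t‖ + ‖V‖ * ‖fh t‖ + ‖δ t‖ :=
    (norm_sub_le _ _).trans (add_le_add_left ((norm_add_le _ _).trans
      (add_le_add (P.le_opNorm _) (V.le_opNorm _))) _)
  have u₂ : ‖P (eh t) + V (fh t) - δ t‖ ^ 2 ≤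
      N * (‖eh t‖ ^ 2 + ‖fh t‖ ^ 2 + ‖δ t‖ ^ 2) := by
    refine (pow_le_pow_left₀ (norm_nonneg _) u₁ 2).trans ?_
    have s₁ : (‖P‖ * ‖eh t‖ + ‖V‖ * ‖fh t‖ + ‖δ t‖) ^ 2 ≤
        3 * ((‖P‖ * ‖eh t‖) ^ 2 + (‖V‖ * ‖fh t‖) ^ 2 + ‖δ t‖ ^ 2) := by
      nlinarith [sq_nonneg (‖P‖ * ‖eh t‖ - ‖V‖ * ‖fh t‖), sq_nonneg (‖P‖ * ‖eh t‖ - ‖δ t‖),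
        sq_nonneg (‖V‖ * ‖fh t‖ - ‖δ t‖)]
    have s₂ : N * (‖eh t‖ ^ 2 + ‖fh t‖ ^ 2 + ‖δ t‖ ^ 2) =
        3 * ((‖P‖ * ‖eh t‖) ^ 2 + (‖V‖ * ‖fh t‖) ^ 2 + ‖δ t‖ ^ 2) +
        3 * ((‖V‖ ^ 2 + 1) * ‖eh t‖ ^ 2 + (‖P‖ ^ 2 + 1) * ‖fh t‖ ^ 2 +
          (‖P‖ ^ 2 + ‖V‖ ^ 2) * ‖δ t‖ ^ 2) := by
      simp only [N]; ring
    rw [s₂]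
    exact s₁.trans (le_add_of_nonneg_right (by positivity))
  calc ‖P (eh t) + V (fh t) - δ t‖ ^ 2 ≤ N * (‖eh t‖ ^ 2 + ‖fh t‖ ^ 2 + ‖δ t‖ ^ 2) := u₂
    _ ≤ N * (C₁ * (X * r) + (C₂ * (X * r) + C₂ * M ^ 2)) := by gcongr
    _ = N * (C₁ + C₂) * X * r + N * C₂ * M ^ 2 := by ring
    _ ≤ _ := by
      gcongr
      linarith

theorem IsErrorDynamics.continuousOn_input {G : SimpleGraph (Fin n)} [DecidableRel G.Adj]
    {D : Design n} {w e f eh fh δ : ℝ → Stack n} (h : IsErrorDynamics G D w e f eh fh δ) :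
    ContinuousOn (fun t => gainOp G D.κp D.cp (eh t) + gainOp G D.κv D.cv (fh t) - δ t)
      (Ici 0) :=
  (((gainOp G D.κp D.cp).continuous.comp_continuousOn h.leaderPos.continuousOn).add
    ((gainOp G D.κv D.cv).continuous.comp_continuousOn h.leaderVel.continuousOn)).sub
    h.est.continuousOn

/-- Exponential decay of the error state up to the size of the disturbance rate. -/
theorem exists_state_decay (G : SimpleGraph (Fin n)) [DecidableRel G.Adj] {D : Design n}
    (hD : D.Admissible) : ∃ C l, 0 < C ∧ 0 < l ∧ ∀ w e f eh fh δ : ℝ → Stack n,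
      IsErrorDynamics G D w e f eh fh δ →
      ∀ t M : ℝ, 0 ≤ t → (∀ s ∈ Icc 0 t, ‖w s‖ ≤ M) →
      ‖e t‖ ^ 2 + ‖f t‖ ^ 2 + ‖eh t‖ ^ 2 + ‖fh t‖ ^ 2 + ‖δ t‖ ^ 2 ≤ C * (Real.exp (-l * t) *
        (‖e 0‖ ^ 2 + ‖f 0‖ ^ 2 + ‖eh 0‖ ^ 2 + ‖fh 0‖ ^ 2 + ‖δ 0‖ ^ 2) + M ^ 2) := by
  obtain ⟨C₁, μ, hC₁, hμ, h₁⟩ := exists_input_decay G hD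
  obtain ⟨p, v, m, hPV⟩ := exists_isDamped G hD.Kp_pos hD.Kv_pos hD.Cp_pos hD.Cv_pos
  obtain ⟨C₂, l, hC₂, hl, hlμ, h₂⟩ := hPV.exists_decay hμ
  refine ⟨C₂ * (1 + C₁) + 2 * C₁, l, by positivity, hl, ?_⟩
  intro w e f eh fh δ h t M ht hM
  have h' := h₁ D.Kp D.Kv w e f eh fh δ h
  set X := ‖eh 0‖ ^ 2 + ‖fh 0‖ ^ 2 + ‖δ 0‖ ^ 2 with hX
  have hX0 : 0 ≤ X := by positivity
  obtain ⟨a₁, a₂, -⟩ := h' t M ht hM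
  have a₃ := h₂ e f _ h.pos h.vel h.continuousOn_input t (C₁ * X) (C₁ * M ^ 2) ht (by positivity)
    (by positivity) fun s hs => (h' s M hs.1 fun τ hτ => hM τ ⟨hτ.1, hτ.2.trans hs.2⟩).2.2
  have hexp : Real.exp (-μ * t) ≤ Real.exp (-l * t) := Real.exp_le_exp.2 (by nlinarith)
  set Y := ‖e 0‖ ^ 2 + ‖f 0‖ ^ 2 with hY
  have hY0 : 0 ≤ Y := by positivity
  have hYX : ‖e 0‖ ^ 2 + ‖f 0‖ ^ 2 + ‖eh 0‖ ^ 2 + ‖fh 0‖ ^ 2 + ‖δ 0‖ ^ 2 = Y + X := by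
    rw [hX, hY]; ring
  have b₁ : C₁ * X * Real.exp (-μ * t) ≤ C₁ * X * Real.exp (-l * t) := by gcongr
  rw [hYX]
  have e1 : (C₂ * (1 + C₁) + 2 * C₁) * (Real.exp (-l * t) * (Y + X) + M ^ 2) =
      C₂ * (Real.exp (-l * t) * (Y + C₁ * X) + C₁ * M ^ 2) +
      (C₁ * X * Real.exp (-l * t)) + (C₁ * X * Real.exp (-l * t) + C₁ * M ^ 2) +
      (C₂ * (Real.exp (-l * t) * (X + C₁ * Y) + M ^ 2) +
        2 * C₁ * (Real.exp (-l * t) * Y) + C₁ * M ^ 2) := by ring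
  have e2 : 0 ≤ C₂ * (Real.exp (-l * t) * (X + C₁ * Y) + M ^ 2) +
        2 * C₁ * (Real.exp (-l * t) * Y) + C₁ * M ^ 2 := by positivity
  rw [e1]
  linarith

/-! ### Input-to-state stability -/

theorem tendsto_mul_exp_neg_mul {l : ℝ} (hl : 0 < l) (a : ℝ) :
    Tendsto (fun t : ℝ => a * Real.exp (-l * t)) atTop (𝓝 0) := by
  have h : Tendsto (fun t : ℝ => Real.exp (-l * t)) atTop (𝓝 0) :=
    Real.tendsto_exp_atBot.comp (tendsto_id.const_mul_atTop_of_neg (neg_lt_zero.2 hl))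
  simpa using h.const_mul a

theorem isClassKL_exp {K l : ℝ} (hK : 0 < K) (hl : 0 < l) :
    IsClassKL fun s t => K * s * Real.exp (-l * t) := by
  refine ⟨?_, fun t _ => ⟨?_, fun s _ s' _ hs => ?_, by simp⟩,
    fun s hs => ⟨fun t _ t' _ ht => ?_, ?_⟩⟩
  · refine Continuous.continuousOn ?_
    simp only [Function.uncurry_def]
    fun_prop
  · fun_prop
  · simp only
    gcongr
  · simp only
    refine mul_le_mul_of_nonneg_left (Real.exp_le_exp.2 (by nlinarith)) (by positivity)
  · exact tendsto_mul_exp_neg_mul hl (K * s)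

theorem isClassK_mul {K : ℝ} (hK : 0 < K) : IsClassK fun s => K * s :=
  ⟨by fun_prop, fun s _ s' _ hs => mul_lt_mul_of_pos_left hs hK, by simp⟩

theorem IsBoundedInput.hasRate {w : ℝ → Stack n} (hw : IsBoundedInput w) (d₀ : Stack n) :
    HasRate (fun t => d₀ + ∫ s in (0 : ℝ)..t, w s) w := by
  intro t ht
  refine ⟨?_, by simp⟩
  obtain ⟨B, hB⟩ := hw.2
  rw [intervalIntegrable_iff_integrableOn_Ioc_of_le ht]
  have hsub : Ioc 0 t ⊆ Ici (0 : ℝ) := fun s hs => hs.1.le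
  refine IntegrableOn.of_bound measure_Ioc_lt_top
    (hw.1.mono_measure (Measure.restrict_mono hsub le_rfl)) B ?_
  filter_upwards [ae_restrict_mem measurableSet_Ioc] with s hs
  exact hB (mem_image_of_mem _ (hsub hs))

theorem norm_sq_errorState (a b c d e : Stack n) :
    ‖(WithLp.toLp 2 ![a, b, c, d, e] : ErrorState n)‖ ^ 2 =
      ‖a‖ ^ 2 + ‖b‖ ^ 2 + ‖c‖ ^ 2 + ‖d‖ ^ 2 + ‖e‖ ^ 2 := by
  rw [PiLp.norm_sq_eq_of_L2, Fin.sum_univ_five]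
  rfl

theorem inputToStateStable_errorSystem (G : SimpleGraph (Fin n)) [DecidableRel G.Adj]
    {D : Design n} (hD : D.Admissible) : InputToStateStable (errorSystem G D) := by
  obtain ⟨C, l, hC, hl, h⟩ := exists_state_decay G hD
  refine ⟨_, _, isClassKL_exp (K := C + 1) (l := l / 2) (by positivity) (by positivity),
    isClassK_mul (K := C + 1) (by positivity), fun w hw => ⟨fun x₀ => ?_, ?_⟩⟩
  · have hr : IsReference (n := n) (fun _ => 0) (fun _ => 0) (fun _ => 0) :=
      ⟨HasRate.const 0, HasRate.const 0⟩
    obtain ⟨p, v, rh, vh, hcl, hp, hv, hrh, hvh⟩ := exists_isClosedLoop G D hr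
      (hw.hasRate (-x₀ 4)) (x₀ 0 + x₀ 2) (x₀ 1 + x₀ 3) (x₀ 2) (x₀ 3)
    refine ⟨_, ⟨_, _, _, _, p, v, rh, vh, hr, hw.hasRate (-x₀ 4), hcl, fun t _ => rfl⟩, ?_⟩
    have hest : estimate G D (fun _ => 0) rh vh p v 0 = 0 := by
      ext i ρ
      simp [estimate, observer]
    ext1 j
    fin_cases j <;> simp [errorSignal, hp, hv, hrh, hvh, hest]
  · rintro x ⟨r, r₁, r₂, d, p, v, rh, vh, hr, hd, hcl, hx⟩ t ht
    let M := sSup ((fun τ => ‖w τ‖) '' Icc 0 t)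
    have hbdd : BddAbove ((fun τ => ‖w τ‖) '' Icc 0 t) :=
      hw.2.mono (image_mono Icc_subset_Ici_self)
    have hM : ∀ s ∈ Icc 0 t, ‖w s‖ ≤ M := fun s hs => le_csSup hbdd (mem_image_of_mem _ hs)
    have hM0 : 0 ≤ M := (norm_nonneg _).trans (hM 0 ⟨le_rfl, ht⟩)
    have h1 := h _ _ _ _ _ _ (hcl.isErrorDynamics hr hd) t M ht hM
    rw [← norm_sq_errorState, ← norm_sq_errorState] at h1
    change ‖errorSignal G D r r₁ r₂ d p v rh vh t‖ ^ 2 ≤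
      C * (Real.exp (-l * t) * ‖errorSignal G D r r₁ r₂ d p v rh vh 0‖ ^ 2 + M ^ 2) at h1
    rw [← hx t ht, ← hx 0 le_rfl] at h1
    change ‖x t‖ ≤ (C + 1) * ‖x 0‖ * Real.exp (-(l / 2) * t) + (C + 1) * M
    have e1 : Real.exp (-l * t) = Real.exp (-(l / 2) * t) ^ 2 := by
      rw [← Real.exp_nat_mul]; congr 1; push_cast; ring
    rw [e1] at h1
    set y := Real.exp (-(l / 2) * t) * ‖x 0‖ with hy
    have hy0 : 0 ≤ y := by positivity
    refine abs_le_of_sq_le_sq' ?_ (by positivity) |>.2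
    calc ‖x t‖ ^ 2 ≤ C * (y ^ 2 + M ^ 2) := by rw [hy, mul_pow]; exact h1
      _ ≤ (C + 1) ^ 2 * (y + M) ^ 2 := by
        refine mul_le_mul (by nlinarith) ?_ (by positivity) (by positivity)
        nlinarith
      _ = _ := by rw [hy]; ring

/-! ### Formation flight -/

theorem norm_le_of_abs_le {x : Stack n} {b : Fin n → Fin 3 → ℝ} (h : ∀ i ρ, |x i ρ| ≤ b i ρ) :
    ‖x‖ ≤ ∑ i, ∑ ρ, b i ρ :=
  (norm_le_sum_abs x).trans (Finset.sum_le_sum fun i _ => Finset.sum_le_sum fun ρ _ => h i ρ)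

theorem FormationBound.of_error_bound {G : SimpleGraph (Fin n)} [DecidableRel G.Adj]
    {D : Design n} {dbar wbar : Fin n → Fin 3 → ℝ} {ε εp εv : ℝ} (hε : 0 ≤ ε) (hp : 2 * ε ≤ εp)
    (hv : 2 * ε ≤ εv)
    (h : ∀ w e f eh fh δ : ℝ → Stack n, IsErrorDynamics G D w e f eh fh δ →
      (∀ t, 0 ≤ t → ‖w t‖ ≤ ∑ i, ∑ ρ, wbar i ρ) → ∀ᶠ t in atTop,
        ‖e t‖ ^ 2 + ‖f t‖ ^ 2 ≤ ε ^ 2 ∧ ‖eh t‖ ^ 2 + ‖fh t‖ ^ 2 ≤ ε ^ 2) :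
    FormationBound G D dbar wbar εp εv := by
  intro r r₁ r₂ d w hr hd
  refine ⟨exists_isClosedLoop G D hr hd.rate, fun p v rh vh hcl => ?_⟩
  filter_upwards [h _ _ _ _ _ _ (hcl.isErrorDynamics hr hd.rate)
    fun t ht => norm_le_of_abs_le (hd.rate_bound t ht)] with t ⟨h1, h2⟩ i
  have key : ∀ a b c : Stack n, ‖a - b‖ ^ 2 ≤ ε ^ 2 → ‖b - c‖ ^ 2 ≤ ε ^ 2 →
      ‖a i - c i‖ ≤ 2 * ε := fun a b c hab hbc => by
    have h1 := (abs_le_of_sq_le_sq' hab hε).2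
    have h2 := (abs_le_of_sq_le_sq' hbc hε).2
    have h3 : ‖a i - c i‖ ≤ ‖a - c‖ := PiLp.norm_apply_le (a - c) i
    linarith [norm_sub_le_norm_sub_add_norm_sub a b c]
  have q1 := sq_nonneg ‖p t - rh t‖
  have q2 := sq_nonneg ‖v t - vh t‖
  have q3 := sq_nonneg ‖rh t - r t‖
  have q4 := sq_nonneg ‖vh t - r₁ t‖
  exact ⟨(key _ (rh t) _ (by linarith) (by linarith)).trans hp,
    (key _ (vh t) _ (by linarith) (by linarith)).trans hv⟩

theorem exists_formationBound (G : SimpleGraph (Fin n)) [DecidableRel G.Adj] {D : Design n}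
    (hD : D.Admissible) (dbar wbar : Fin n → Fin 3 → ℝ) :
    ∃ ε, 0 < ε ∧ FormationBound G D dbar wbar ε ε := by
  obtain ⟨C, l, hC, hl, h⟩ := exists_state_decay G hD
  set M := ∑ i, ∑ ρ, wbar i ρ with hM
  let ε := (C + 1) * (M ^ 2 + 1)
  have hε : 0 < ε := by positivity
  refine ⟨2 * ε, by positivity, FormationBound.of_error_bound hε.le le_rfl le_rfl ?_⟩
  intro w e f eh fh δ hed hw
  filter_upwards [(tendsto_mul_exp_neg_mul hl
      (‖e 0‖ ^ 2 + ‖f 0‖ ^ 2 + ‖eh 0‖ ^ 2 + ‖fh 0‖ ^ 2 + ‖δ 0‖ ^ 2)).eventually_le_const one_pos,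
    eventually_ge_atTop 0] with t h1 ht
  have h2 := h w e f eh fh δ hed t M ht fun s hs => hw s hs.1
  rw [mul_comm (Real.exp _)] at h2
  have h3 : C * (M ^ 2 + 1) ≤ ε ^ 2 := by
    have : 1 ≤ M ^ 2 + 1 := by nlinarith
    calc C * (M ^ 2 + 1) ≤ (C + 1) ^ 2 * (M ^ 2 + 1) ^ 2 := by
          refine mul_le_mul (by nlinarith) (by nlinarith) (by positivity) (by positivity)
      _ = ε ^ 2 := by rw [← mul_pow]
  have h4 := mul_le_mul_of_nonneg_left (add_le_add_left h1 (M ^ 2)) hC.le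
  have q1 := sq_nonneg ‖e t‖
  have q2 := sq_nonneg ‖f t‖
  have q3 := sq_nonneg ‖eh t‖
  have q4 := sq_nonneg ‖fh t‖
  have q5 := sq_nonneg ‖δ t‖
  exact ⟨by linarith, by linarith⟩

theorem exists_gains_formationBound (G : SimpleGraph (Fin n)) [DecidableRel G.Adj] {D : Design n}
    (hD : D.Admissible) (dbar wbar : Fin n → Fin 3 → ℝ) {εp εv : ℝ} (hεp : 0 < εp)
    (hεv : 0 < εv) : ∃ Kp Kv : Fin 3 → ℝ, (∀ ρ, 0 < Kp ρ) ∧ (∀ ρ, 0 < Kv ρ) ∧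
      FormationBound G { D with Kp := Kp, Kv := Kv } dbar wbar εp εv := by
  obtain ⟨C, μ, hC, hμ, h⟩ := exists_input_decay G hD
  set M := ∑ i, ∑ ρ, wbar i ρ with hM
  let ε := min εp εv / 2
  have hε : 0 < ε := by positivity
  let k := 1 + ‖gainOp G 0 D.Cv‖ + 4 * μ + 20 * C * M ^ 2 / (μ * ε ^ 2)
  have hz : 0 ≤ 20 * C * M ^ 2 / (μ * ε ^ 2) := by positivity
  have hN : 0 ≤ ‖gainOp G 0 D.Cv‖ := norm_nonneg _
  have hk1 : 1 ≤ k := by simp only [k]; linarith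
  have hk : 0 < k := by linarith
  have hkN : ‖gainOp G 0 D.Cv‖ ≤ k := by simp only [k]; linarith
  have hkμ : 4 * μ ≤ k := by simp only [k]; linarith
  have hkC : 20 * C * M ^ 2 / (μ * ε ^ 2) ≤ k := by simp only [k]; linarith
  have hPV := isDamped_const G hD.Cp_pos hD.Cv_pos hk hkN
  refine ⟨fun _ => k ^ 2, fun _ => k, fun _ => by positivity, fun _ => hk,
    FormationBound.of_error_bound (ε := ε) hε.le ?_ ?_ ?_⟩
  · have := min_le_left εp εv
    simp only [ε]; linarith
  · have := min_le_right εp εv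
    simp only [ε]; linarith
  intro w e f eh fh δ hed hw
  have h' := h _ _ w e f eh fh δ hed
  set X := ‖eh 0‖ ^ 2 + ‖fh 0‖ ^ 2 + ‖δ 0‖ ^ 2 with hX
  have hX0 : 0 ≤ X := by positivity
  have hrate : μ / 2 ≤ k / 4 / (1 + k ^ 2 / (8 * k ^ 2) + k * (2 / k) / 4) := by
    have e1 : 1 + k ^ 2 / (8 * k ^ 2) + k * (2 / k) / 4 = 13 / 8 := by
      field_simp
      norm_num
    rw [e1]
    linarith
  have hg : 1 / k + k / (4 * k ^ 2) = 5 / (4 * k) := by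
    field_simp
    norm_num
  let a := energy (gainOp G (fun _ => k ^ 2) D.Cp) (gainOp G (fun _ => k) D.Cv) k (e 0) (f 0) +
      (1 / k + k / (4 * k ^ 2)) * (C * X) / (μ - μ / 2)
  have hdecay : ∀ t, 0 ≤ t → energy (gainOp G (fun _ => k ^ 2) D.Cp)
      (gainOp G (fun _ => k) D.Cv) k (e t) (f t) ≤
      Real.exp (-(μ / 2) * t) * a + (1 / k + k / (4 * k ^ 2)) * (C * M ^ 2) / (μ / 2) :=
    fun t ht => hPV.energy_decay hed.pos hed.vel hed.continuousOn_input ht (by positivity)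
      (by linarith) hrate (by positivity) (by positivity) fun s hs =>
        (h' s M hs.1 fun τ hτ => hw τ hτ.1).2.2
  have hsmall : (1 / k + k / (4 * k ^ 2)) * (C * M ^ 2) / (μ / 2) ≤ ε ^ 2 / 8 := by
    rw [div_le_iff₀ (by positivity)] at hkC
    rw [hg, div_le_iff₀ (by positivity), div_mul_eq_mul_div, div_le_iff₀ (by positivity)]
    linarith
  filter_upwards [(tendsto_mul_exp_neg_mul (half_pos hμ) a).eventually_le_const
      (by positivity : 0 < ε ^ 2 / 8),
    (tendsto_mul_exp_neg_mul hμ (C * X)).eventually_le_const (by positivity : 0 < ε ^ 2),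
    eventually_ge_atTop 0] with t h1 h2 ht
  refine ⟨?_, (h' t M ht fun τ hτ => hw τ hτ.1).1.trans h2⟩
  have h3 := hdecay t ht
  have h4 := hPV.le_energy (e t) (f t)
  have h5 : ‖e t‖ ^ 2 ≤ k ^ 2 * ‖e t‖ ^ 2 :=
    le_mul_of_one_le_left (sq_nonneg _) (one_le_pow₀ hk1)
  rw [mul_comm (Real.exp _)] at h3
  have := sq_nonneg ‖e t‖
  linarith

end FormationControl

theorem theorem2 (n : ℕ) (G : SimpleGraph (Fin n)) [DecidableRel G.Adj] (hG : G.Connected)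
    (D : FormationControl.Design n) (hD : D.Admissible) (dbar wbar : Fin n → Fin 3 → ℝ) :
    FormationControl.InputToStateStable (FormationControl.errorSystem G D) ∧
    (∃ εp : ℝ, 0 < εp ∧ ∃ εv : ℝ, 0 < εv ∧
      FormationControl.FormationBound G D dbar wbar εp εv) ∧
    (∀ εp : ℝ, 0 < εp → ∀ εv : ℝ, 0 < εv → ∃ Kp Kv : Fin 3 → ℝ,
      (∀ ρ, 0 < Kp ρ) ∧ (∀ ρ, 0 < Kv ρ) ∧
      FormationControl.FormationBound G { D with Kp := Kp, Kv := Kv } dbar wbar εp εv) := by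
  obtain ⟨ε, hε, h⟩ := FormationControl.exists_formationBound G hD dbar wbar
  exact ⟨FormationControl.inputToStateStable_errorSystem G hD, ⟨ε, hε, ε, hε, h⟩,
    fun εp hεp εv hεv => FormationControl.exists_gains_formationBound G hD dbar wbar hεp hεv⟩
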